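/- All graphs are finite and simple. For a graph $T$ with $n$ vertices and adjacency eigenvalues $\lambda_1,\dots,\lambda_n$ (with multiplicity), let $M_k(T)=\sum_{i=1}^n\lambda_i^k$ be its $k$-th spectral moment. The independence number of $T$ is the largest size of a set of pairwise non-adjacent vertices; the matching number is the largest size of a set of pairwise disjoint edges. For a tree $T$ rooted at $r$, level $h\ge 0$ consists of the vertices at distance $h$ from $r$. The rooted tree is *level greedy* if the vertices of each level $h$ can be labeled $g^h_1,g^h_2,\dots$ such that their degrees are non-increasing, $\deg g^h_1\ge\deg g^h_2\ge\cdots$, and such that the children of $g^h_1,g^h_2,\dots$ are, in this order, consecutive blocks of the sequence $g^{h+1}_1,g^{h+1}_2,\dots$. A tree is *greedy* if some vertex can be chosen as root so that it becomes level greedy and, for every $h$, each degree on level $h$ is at least each degree on level $h+1$. **Corollary.** Let $n,\alpha$ be integers with $n/2\le\alpha\le n-1$. Up to isomorphism there is exactly one greedy tree $G$ with degree sequence $(\alpha,2,\dots,2,1,\dots,1)$, in which $\alpha$ is followed by $n-\alpha-1$ twos and $\alpha$ ones. It has independence number $\alpha$ and matching number $n-\alpha$. A tree $T$ on $n$ vertices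 has independence number $\alpha$ if and only if it has matching number $n-\alpha$, and every such tree satisfies $$M_k(T)\le M_k(G)\qquad\text{for all integers } k\ge 0.$$ -/

import Mathlib

/-- The `k`-th spectral moment `∑ λᵢ ^ k`, where the `λᵢ` are the eigenvalues of the (real)
adjacency matrix of `G`, with multiplicity. -/
noncomputable def SimpleGraph.spectralMoment {V : Type*} [Fintype V] (G : SimpleGraph V)
    (k : ℕ) : ℝ :=
  open Classical in
  ∑ i : V, (Matrix.IsHermitian.eigenvalues (A := G.adjMatrix ℝ)
    (G.isSymm_adjMatrix (α := ℝ)) i) ^ k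

/-- The matching number: the largest number of edges in a matching of `G`. -/
noncomputable def SimpleGraph.matchingNum {V : Type*} (G : SimpleGraph V) : ℕ :=
  sSup {m | ∃ M : G.Subgraph, M.IsMatching ∧ M.edgeSet.ncard = m}

/-- The non-increasing list `D` is the degree sequence of `G`. -/
def SimpleGraph.HasDegreeSequence {V : Type*} [Fintype V] (G : SimpleGraph V)
    (D : List ℕ) : Prop :=
  open Classical in
  D.Pairwise (· ≥ ·) ∧ (D : Multiset ℕ) = Finset.univ.val.map (fun v => G.degree v)

/-- The leveled degree sequence of the tree `G` rooted at `r`: entry `h` is the non-increasing list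
of the degrees of the vertices at distance `h` from the root (levels are numbered from `0`;
the list is empty beyond the height). -/
noncomputable def SimpleGraph.leveledDegreeSequence {V : Type*} [Fintype V] (G : SimpleGraph V)
    (r : V) (h : ℕ) : List ℕ :=
  open Classical in
  ((Finset.univ.filter (fun v => G.dist r v = h)).val.map (fun v => G.degree v)).sort (· ≥ ·)

/-- The number of children of a vertex of degree `d` on level `h` of a rooted forest: a root has
`d` children, any other vertex has `d - 1` (one of its neighbors is its parent). -/
def childCount (h d : ℕ) : ℕ := if h = 0 then d else d - 1

/-- The level greedy forest with leveled degree sequence `D`. The vertex `⟨h, j⟩` is the `j`-th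
vertex of level `h` (both numbered from `0`) and is assigned the degree `(D h)[j]`. The vertices of
level `h` take their children from level `h + 1` in order: the children of `⟨h, j⟩` form the block
of `childCount h (D h)[j]` consecutive vertices that starts right after the blocks of
`⟨h, 0⟩, …, ⟨h, j - 1⟩`. -/
def levelGreedyForest (D : ℕ → List ℕ) : SimpleGraph (Σ h : ℕ, Fin (D h).length) :=
  SimpleGraph.fromRel fun x y =>
    y.1 = x.1 + 1 ∧
    (((D x.1).take (x.2 : ℕ)).map (childCount x.1)).sum ≤ (y.2 : ℕ) ∧
    (y.2 : ℕ) < (((D x.1).take ((x.2 : ℕ) + 1)).map (childCount x.1)).sum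

/-- The tree `G` rooted at `r` is a level greedy tree: as a rooted tree it is isomorphic to the
level greedy forest with the same leveled degree sequence. -/
def SimpleGraph.IsLevelGreedyTree {V : Type*} [Fintype V] (G : SimpleGraph V) (r : V) : Prop :=
  G.IsTree ∧ ∃ e : G ≃g levelGreedyForest (G.leveledDegreeSequence r), (e r).1 = 0

/-- `G` is a greedy tree: for some choice of root it is a level greedy tree in which no degree on a
level exceeds a degree on the preceding level. -/
def SimpleGraph.IsGreedyTree {V : Type*} [Fintype V] (G : SimpleGraph V) : Prop :=
  ∃ r : V, G.IsLevelGreedyTree r ∧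
    ∀ h : ℕ, ∀ a ∈ G.leveledDegreeSequence r h, ∀ b ∈ G.leveledDegreeSequence r (h + 1), b ≤ a

/-! ### Spectral moments from the determinant of 1 - XA -/

section MomentSeries

open PowerSeries Matrix

variable {V : Type*} [Fintype V]

/-! Put a = n - α - 1 and b = 2α + 1 - n ≥ 1. The greedy tree in question is the spider whose center
carries a legs of length two and b legs of length one.

By König's theorem a tree with independence number α has a matching with n - α = a + 1 edges
(`IsTree.exists_isMatchingMap_card`). Fix this matching and move branches along edges uv: a set W of
neighbors of u becomes a set of neighbors of v, without touching a matching edge. If, once W is cut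
off, closed walks of each length are at most as numerous at u as at v, no spectral moment decreases
(`IsShiftable.spectralMoment_le`). The moves used also increase the sum of squared degrees, so the
process stops. A tree that admits no such move is a spider
(`IsTree.exists_isSpider_of_forall_not_isImprovement`); the matching size fixes its number of long
legs, and n then fixes the number of short ones.

Moments are compared through det(1 - XA) = ∏ (1 - λX), whose logarithmic derivative generates them.
Joining W to u multiplies this determinant by 1 - X² R ω, where R counts closed walks at u and ω
counts walks between members of W, both before the joining (`Matrix.det_oneSubX_attach`). Enlarging
R coefficientwise enlarges every moment.

For uniqueness, a greedy tree with the given degrees has its vertex of degree α at the root, some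
leaf on level 1, and therefore only leaves on level 2: it is the same spider. -/

theorem Polynomial.reverse_prod_of_domain {R ι : Type*} [CommRing R] [IsDomain R]
    (s : Finset ι) (f : ι → Polynomial R) :
    (∏ i ∈ s, f i).reverse = ∏ i ∈ s, (f i).reverse := by
  classical
  induction s using Finset.induction_on with
  | empty => simpa using Polynomial.reverse_C (1 : R)
  | insert i s hi ih => rw [Finset.prod_insert hi, Finset.prod_insert hi,
      Polynomial.reverse_mul_of_domain, ih]

theorem Polynomial.reverse_X_sub_C {R : Type*} [CommRing R] [IsDomain R] (a : R) :
    (Polynomial.X - Polynomial.C a).reverse = 1 - Polynomial.C a * Polynomial.X := by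
  rw [sub_eq_add_neg, ← Polynomial.C_neg, Polynomial.reverse_add_C]
  have : (Polynomial.X : Polynomial R).reverse = 1 := by
    have h := Polynomial.reverse_mul_X (1 : Polynomial R)
    rw [one_mul] at h
    rw [h]
    simpa using Polynomial.reverse_C (1 : R)
  simp [sub_eq_add_neg, this]

/-- The power series matrix `1 - X A`. -/
noncomputable def Matrix.oneSubX [DecidableEq V] (A : Matrix V V ℝ) : Matrix V V ℝ⟦X⟧ :=
  1 - (X : ℝ⟦X⟧) • A.map (PowerSeries.C (R := ℝ))

/-- Reversing the characteristic polynomial turns each factor X - λ into 1 - λX. Passing to power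
series makes these factors invertible. -/
theorem Matrix.IsHermitian.det_oneSubX [DecidableEq V] {A : Matrix V V ℝ} (hA : A.IsHermitian) :
    A.oneSubX.det = ∏ i, (1 - PowerSeries.C (hA.eigenvalues i) * X) := by
  have h1 : A.charpolyRev = ∏ i, (1 - Polynomial.C (hA.eigenvalues i) * Polynomial.X) := by
    rw [← Matrix.reverse_charpoly, hA.charpoly_eq, Polynomial.reverse_prod_of_domain]
    exact Finset.prod_congr rfl fun i _ => Polynomial.reverse_X_sub_C _
  have h2 := congrArg (Polynomial.coeToPowerSeries.ringHom (R := ℝ)) h1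
  rw [Matrix.charpolyRev, RingHom.map_det, map_prod] at h2
  convert h2 using 2
  · ext1 i j
    by_cases h : i = j <;>
      simp [Matrix.oneSubX, h, PowerSeries.commute_X _ |>.eq]
  · simp

/-- Logarithmic differentiation with denominators cleared: one factor contributes -λX/(1 - λX) = 1 -
1/(1 - λX), and 1/(1 - λX) generates the powers of λ. -/
theorem X_mul_derivative_prod {ι : Type*} (s : Finset ι) (l : ι → ℝ) :
    X * d⁄dX ℝ (∏ i ∈ s, (1 - PowerSeries.C (l i) * X)) =
      (∏ i ∈ s, (1 - PowerSeries.C (l i) * X)) *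
        ((s.card : ℝ⟦X⟧) - PowerSeries.mk fun k => ∑ i ∈ s, l i ^ k) := by
  classical
  have geom (a : ℝ) : (1 - PowerSeries.C a * X) * (PowerSeries.mk fun k => a ^ k) = 1 := by
    ext n
    cases n with
    | zero => simp [sub_mul, mul_assoc]
    | succ n => simp [sub_mul, mul_assoc, coeff_succ_X_mul, pow_succ', coeff_one]
  induction s using Finset.induction_on with
  | empty =>
    have : (PowerSeries.mk fun _ => (0 : ℝ)) = 0 := by ext; simp
    simp [this]
  | insert i s hi ih =>
    have hs : (PowerSeries.mk fun k => ∑ j ∈ insert i s, l j ^ k) =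
        (PowerSeries.mk fun k => l i ^ k) + PowerSeries.mk fun k => ∑ j ∈ s, l j ^ k := by
      ext n; simp [Finset.sum_insert hi]
    rw [Finset.prod_insert hi, Finset.card_insert_of_notMem hi, hs, Derivation.leibniz]
    simp only [smul_eq_mul, map_sub, Derivation.leibniz, derivative_C, derivative_X]
    have g := geom (l i)
    have h1 : d⁄dX ℝ (1 : ℝ⟦X⟧) = 0 := by simp
    rw [h1]
    push_cast
    set p := ∏ i ∈ s, (1 - PowerSeries.C (l i) * X)
    linear_combination (1 - PowerSeries.C (l i) * X) * ih + p * g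

/-- All coefficients of the power series are nonnegative. -/
def PowerSeries.CoeffNonneg (f : ℝ⟦X⟧) : Prop := ∀ n, 0 ≤ coeff n f

namespace PowerSeries.CoeffNonneg

theorem mul {f g : ℝ⟦X⟧} (hf : f.CoeffNonneg) (hg : g.CoeffNonneg) : (f * g).CoeffNonneg := by
  intro n
  rw [coeff_mul]
  exact Finset.sum_nonneg fun p _ => mul_nonneg (hf _) (hg _)

theorem add {f g : ℝ⟦X⟧} (hf : f.CoeffNonneg) (hg : g.CoeffNonneg) : (f + g).CoeffNonneg := by
  intro n
  rw [map_add]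
  exact add_nonneg (hf n) (hg n)

theorem X : (PowerSeries.X : ℝ⟦X⟧).CoeffNonneg := by
  intro n
  rw [coeff_X]
  split_ifs <;> norm_num

theorem derivative {f : ℝ⟦X⟧} (hf : f.CoeffNonneg) : (d⁄dX ℝ f).CoeffNonneg := by
  intro n
  rw [coeff_derivative]
  exact mul_nonneg (hf _) (by positivity)

/-- Here J = 1/(1 - Y). Since Y has no constant term, each coefficient of J is determined by earlier
ones without subtraction. -/
theorem of_eq_one_add_mul {Y J : ℝ⟦X⟧} (hY : Y.CoeffNonneg) (h0 : coeff 0 Y = 0)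
    (hJ : J = 1 + Y * J) : J.CoeffNonneg := by
  intro n
  induction n using Nat.strong_induction_on with
  | _ n ih =>
    rw [hJ, map_add, coeff_mul]
    refine add_nonneg (by rw [coeff_one]; split_ifs <;> norm_num)
      (Finset.sum_nonneg fun p hp => ?_)
    rcases Nat.eq_zero_or_pos p.1 with h | h
    · rw [h, h0, zero_mul]
    · exact mul_nonneg (hY _) (ih _ (by have := Finset.HasAntidiagonal.mem_antidiagonal.1 hp; omega))

end PowerSeries.CoeffNonneg

/-- Dividing, P = c - X f'/f + X Y'/(1 - Y), so the common factor f drops out of P₂ - P₁. -/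
theorem coeff_le_coeff_of_logDerivative {f Y₁ Y₂ P₁ P₂ c : ℝ⟦X⟧} (hf : f ≠ 0)
    (h₁ : X * d⁄dX ℝ (f * (1 - Y₁)) = f * (1 - Y₁) * (c - P₁))
    (h₂ : X * d⁄dX ℝ (f * (1 - Y₂)) = f * (1 - Y₂) * (c - P₂))
    (hY₁ : Y₁.CoeffNonneg) (hY : (Y₂ - Y₁).CoeffNonneg)
    (h0₁ : coeff 0 Y₁ = 0) (h0₂ : coeff 0 Y₂ = 0) (k : ℕ) : coeff k P₁ ≤ coeff k P₂ := by
  have inv (Y : ℝ⟦X⟧) (h0 : coeff 0 Y = 0) : ∃ J, (1 - Y) * J = 1 := by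
    refine ⟨(1 - Y)⁻¹, PowerSeries.mul_inv_cancel _ ?_⟩
    rw [coeff_zero_eq_constantCoeff_apply] at h0
    simp [h0]
  obtain ⟨J₁, hJ₁⟩ := inv Y₁ h0₁
  obtain ⟨J₂, hJ₂⟩ := inv Y₂ h0₂
  have hY₂ : Y₂.CoeffNonneg := by simpa using hY₁.add hY
  have n₁ := hY₁.of_eq_one_add_mul (J := J₁) h0₁ (by linear_combination hJ₁)
  have n₂ := hY₂.of_eq_one_add_mul (J := J₂) h0₂ (by linear_combination hJ₂)
  -- With Jᵢ = 1/(1 - Yᵢ), the identity J₂ - J₁ = J₁ J₂ (Y₂ - Y₁) leaves only products and sums of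
  -- series with nonnegative coefficients.
  have key : P₂ - P₁ = X * (d⁄dX ℝ (Y₂ - Y₁) * J₂ + d⁄dX ℝ Y₁ * (J₁ * J₂ * (Y₂ - Y₁))) := by
    apply mul_left_cancel₀ hf
    simp only [Derivation.leibniz, smul_eq_mul, map_sub] at h₁ h₂ ⊢
    have hd : d⁄dX ℝ (1 : ℝ⟦X⟧) = 0 := by simp
    rw [hd] at h₁ h₂
    have e₁ : f * P₁ = c * f - X * d⁄dX ℝ f + f * X * d⁄dX ℝ Y₁ * J₁ := by
      linear_combination J₁ * h₁ + (f * P₁ - c * f + X * d⁄dX ℝ f) * -hJ₁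
    have e₂ : f * P₂ = c * f - X * d⁄dX ℝ f + f * X * d⁄dX ℝ Y₂ * J₂ := by
      linear_combination J₂ * h₂ + (f * P₂ - c * f + X * d⁄dX ℝ f) * -hJ₂
    linear_combination e₂ - e₁ + f * X * d⁄dX ℝ Y₁ * (J₁ * hJ₂ - J₂ * hJ₁)
  have : (P₂ - P₁).CoeffNonneg := by
    rw [key]
    exact CoeffNonneg.X.mul ((hY.derivative.mul n₂).add (hY₁.derivative.mul ((n₁.mul n₂).mul hY)))
  have := this k
  rw [map_sub] at this
  linarith

variable [DecidableEq V]

theorem Matrix.IsHermitian.X_mul_derivative_det_oneSubX {A : Matrix V V ℝ}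
    (hA : A.IsHermitian) :
    X * d⁄dX ℝ A.oneSubX.det = A.oneSubX.det *
      ((Fintype.card V : ℝ⟦X⟧) - PowerSeries.mk fun k => ∑ i, hA.eigenvalues i ^ k) := by
  rw [hA.det_oneSubX, X_mul_derivative_prod, Finset.card_univ]

/-- The matrix of the generating functions of the entries of the powers of `A`. -/
noncomputable def Matrix.resolvent (A : Matrix V V ℝ) : Matrix V V ℝ⟦X⟧ :=
  Matrix.of fun x y => PowerSeries.mk fun k => (A ^ k) x y

theorem Matrix.oneSubX_mul_resolvent (A : Matrix V V ℝ) : A.oneSubX * A.resolvent = 1 := by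
  ext x y n
  rw [Matrix.oneSubX, Matrix.sub_mul, Matrix.one_mul, Matrix.smul_mul, Matrix.sub_apply,
    Matrix.smul_apply, Matrix.mul_apply, smul_eq_mul, map_sub]
  cases n with
  | zero => by_cases h : x = y <;> simp [Matrix.resolvent, h, Matrix.one_apply]
  | succ n =>
    have h1 : coeff (n + 1) ((1 : Matrix V V ℝ⟦X⟧) x y) = 0 := by
      by_cases h : x = y <;> simp [Matrix.one_apply, h, coeff_one]
    rw [coeff_succ_X_mul, map_sum, h1]
    simp [Matrix.resolvent, pow_succ', Matrix.mul_apply]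

/-- The matrix `A` with a symmetric pair of copies of `w` added in row and column `u`. -/
def Matrix.attach (A : Matrix V V ℝ) (w : V → ℝ) (u : V) : Matrix V V ℝ :=
  A + Matrix.of fun x y => (if x = u then w y else 0) + (if y = u then w x else 0)

/-- The change is a rank-two update, so `Matrix.det_one_sub_mul_comm` reduces the new factor to a 2
× 2 determinant. As no walk joins `u` to the support of `w`, its diagonal entries are 1 and only the
off-diagonal product survives. -/
theorem Matrix.det_oneSubX_attach (A : Matrix V V ℝ) (w : V → ℝ) (u : V)
    (h₁ : ∀ x k, w x ≠ 0 → (A ^ k) u x = 0) (h₂ : ∀ x k, w x ≠ 0 → (A ^ k) x u = 0) :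
    (A.attach w u).oneSubX.det = A.oneSubX.det *
      (1 - X ^ 2 * A.resolvent u u *
        ∑ x, ∑ y, PowerSeries.C (w x) * A.resolvent x y * PowerSeries.C (w y)) := by
  -- The columns of `L` are the unit vector at `u` and `w`; the rows of `M` are `w` and that unit
  -- vector. Thus `L * M` is exactly the attached part.
  let L : Matrix V (Fin 2) ℝ⟦X⟧ :=
    Matrix.of fun x i => if i = 0 then (if x = u then 1 else 0) else PowerSeries.C (w x)
  let M : Matrix (Fin 2) V ℝ⟦X⟧ :=
    Matrix.of fun i x => if i = 0 then PowerSeries.C (w x) else (if x = u then 1 else 0)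
  have hatt : (A.attach w u).oneSubX = A.oneSubX * (1 - (A.resolvent * (X : ℝ⟦X⟧) • L) * M) := by
    rw [Matrix.mul_sub, Matrix.mul_one, ← Matrix.mul_assoc, ← Matrix.mul_assoc,
      A.oneSubX_mul_resolvent, Matrix.one_mul, Matrix.oneSubX, Matrix.oneSubX, sub_sub]
    congr 1
    rw [Matrix.smul_mul, ← smul_add]
    congr 1
    ext1 x y
    by_cases hx : x = u <;> by_cases hy : y = u <;>
      simp [Matrix.attach, L, M, Matrix.mul_apply, Fin.sum_univ_two, hx, hy]
  have z₁ (x : V) : A.resolvent u x * PowerSeries.C (w x) = 0 := by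
    by_cases hx : w x = 0
    · simp [hx]
    · have : A.resolvent u x = 0 := by ext k; simp [Matrix.resolvent, h₁ x k hx]
      rw [this, zero_mul]
  have z₂ (x : V) : PowerSeries.C (w x) * A.resolvent x u = 0 := by
    by_cases hx : w x = 0
    · simp [hx]
    · have : A.resolvent x u = 0 := by ext k; simp [Matrix.resolvent, h₂ x k hx]
      rw [this, mul_zero]
  rw [hatt, Matrix.det_mul, Matrix.det_one_sub_mul_comm, Matrix.det_fin_two]
  have e00 : (M * (A.resolvent * (X : ℝ⟦X⟧) • L)) 0 0 = 0 := by
    simp only [Matrix.mul_apply, M, L, Matrix.smul_apply, Matrix.of_apply, if_true, smul_eq_mul,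
      mul_ite, mul_one, mul_zero, Finset.sum_ite_eq', Finset.mem_univ]
    refine Finset.sum_eq_zero fun x _ => ?_
    rw [← mul_assoc, z₂, zero_mul]
  have e11 : (M * (A.resolvent * (X : ℝ⟦X⟧) • L)) 1 1 = 0 := by
    simp only [Matrix.mul_apply, M, L, Matrix.smul_apply, Matrix.of_apply, smul_eq_mul,
      one_ne_zero, if_false, ite_mul, one_mul, zero_mul, Finset.sum_ite_eq', Finset.mem_univ,
      if_true]
    refine Finset.sum_eq_zero fun x _ => ?_
    rw [mul_left_comm, z₁, mul_zero]
  have e10 : (M * (A.resolvent * (X : ℝ⟦X⟧) • L)) 1 0 = X * A.resolvent u u := by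
    simp [Matrix.mul_apply, M, L, mul_comm]
  have e01 : (M * (A.resolvent * (X : ℝ⟦X⟧) • L)) 0 1 =
      X * ∑ x, ∑ y, PowerSeries.C (w x) * A.resolvent x y * PowerSeries.C (w y) := by
    simp only [Matrix.mul_apply, M, L, Matrix.smul_apply, Matrix.of_apply, smul_eq_mul,
      one_ne_zero, if_false, if_true, Finset.mul_sum]
    refine Finset.sum_congr rfl fun x _ => Finset.sum_congr rfl fun y _ => by ring
  simp only [Matrix.sub_apply, e00, e11, e10, e01, Matrix.one_apply_eq,
    Matrix.one_apply_ne (show (0 : Fin 2) ≠ 1 by decide),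
    Matrix.one_apply_ne (show (1 : Fin 2) ≠ 0 by decide)]
  ring

theorem Matrix.sum_eigenvalues_pow_attach_le {A : Matrix V V ℝ} {w : V → ℝ} {u v : V}
    (hA : ∀ x y, 0 ≤ A x y) (hw : ∀ x, 0 ≤ w x)
    (hu : ∀ x k, w x ≠ 0 → (A ^ k) u x = 0) (hu' : ∀ x k, w x ≠ 0 → (A ^ k) x u = 0)
    (hv : ∀ x k, w x ≠ 0 → (A ^ k) v x = 0) (hv' : ∀ x k, w x ≠ 0 → (A ^ k) x v = 0)
    (huv : ∀ k, (A ^ k) u u ≤ (A ^ k) v v)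
    (h₁ : (A.attach w u).IsHermitian) (h₂ : (A.attach w v).IsHermitian) (k : ℕ) :
    ∑ i, h₁.eigenvalues i ^ k ≤ ∑ i, h₂.eigenvalues i ^ k := by
  have hpow (k : ℕ) : ∀ x y, 0 ≤ (A ^ k) x y := by
    induction k with
    | zero => intro x y; rw [pow_zero, Matrix.one_apply]; split_ifs <;> norm_num
    | succ k ih =>
      intro x y
      rw [pow_succ, Matrix.mul_apply]
      exact Finset.sum_nonneg fun z _ => mul_nonneg (ih _ _) (hA _ _)
  set ω : ℝ⟦X⟧ := ∑ x, ∑ y, PowerSeries.C (w x) * A.resolvent x y * PowerSeries.C (w y) with hω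
  have nω : ω.CoeffNonneg := by
    intro n
    simp only [hω, map_sum, coeff_mul_C, coeff_C_mul]
    exact Finset.sum_nonneg fun x _ => Finset.sum_nonneg fun y _ =>
      mul_nonneg (mul_nonneg (hw x) (by simpa [Matrix.resolvent] using hpow n x y)) (hw y)
  have nX : ((X : ℝ⟦X⟧) ^ 2).CoeffNonneg := by rw [sq]; exact CoeffNonneg.X.mul CoeffNonneg.X
  have d₁ := h₁.X_mul_derivative_det_oneSubX
  have d₂ := h₂.X_mul_derivative_det_oneSubX
  rw [Matrix.det_oneSubX_attach A w u hu hu'] at d₁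
  rw [Matrix.det_oneSubX_attach A w v hv hv'] at d₂
  have hne : A.oneSubX.det ≠ 0 := by
    intro h
    have := congrArg Matrix.det A.oneSubX_mul_resolvent
    rw [Matrix.det_mul, h, zero_mul, Matrix.det_one] at this
    exact zero_ne_one this
  have := coeff_le_coeff_of_logDerivative hne d₁ d₂
    ((nX.mul fun n => by simpa [Matrix.resolvent] using hpow n u u).mul nω)
    (by
      rw [← sub_mul, ← mul_sub]
      refine (nX.mul fun n => ?_).mul nω
      simpa [Matrix.resolvent] using huv n)
    (by simp) (by simp) k
  simpa using this

end MomentSeries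

/-! ### Moving branches of a tree along an edge -/

section Shift

open scoped Classical

namespace SimpleGraph

variable {V : Type*} {G : SimpleGraph V} {u v : V} {W : Finset V}

/-- The graph `G` without the edges between `u` and `W`. -/
def detach (G : SimpleGraph V) (u : V) (W : Finset V) : SimpleGraph V where
  Adj x y := G.Adj x y ∧ ¬(x = u ∧ y ∈ W) ∧ ¬(y = u ∧ x ∈ W)
  symm := ⟨fun _ _ h => ⟨h.1.symm, h.2.2, h.2.1⟩⟩
  loopless := ⟨fun _ h => h.1.ne rfl⟩

/-- The graph obtained from `G` by replacing the edges between `u` and `W` by edges between `v`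
and `W`. -/
def shift (G : SimpleGraph V) (u v : V) (W : Finset V) : SimpleGraph V where
  Adj x y := (G.detach u W).Adj x y ∨ (x ≠ y ∧ (x = v ∧ y ∈ W ∨ y = v ∧ x ∈ W))
  symm := ⟨fun _ _ h => h.imp (fun h => h.symm) fun h => ⟨h.1.symm, h.2.symm⟩⟩
  loopless := ⟨fun _ h => h.elim (fun h => h.ne rfl) fun h => h.1 rfl⟩

theorem detach_adj {x y : V} : (G.detach u W).Adj x y ↔
    G.Adj x y ∧ ¬(x = u ∧ y ∈ W) ∧ ¬(y = u ∧ x ∈ W) := Iff.rfl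

theorem shift_adj {x y : V} : (G.shift u v W).Adj x y ↔ (G.detach u W).Adj x y ∨
    (x ≠ y ∧ (x = v ∧ y ∈ W ∨ y = v ∧ x ∈ W)) := Iff.rfl

/-- The hypotheses under which `G.shift u v W` moves branches of a tree. -/
structure IsShiftable (G : SimpleGraph V) (u v : V) (W : Finset V) : Prop where
  isTree : G.IsTree
  adj : G.Adj u v
  adj_of_mem : ∀ w ∈ W, G.Adj u w
  notMem : v ∉ W

namespace IsShiftable

variable (h : G.IsShiftable u v W)

include h

theorem self_notMem : u ∉ W := fun hu => (h.adj_of_mem u hu).ne rfl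

theorem detach_adj_left : (G.detach u W).Adj u v :=
  ⟨h.adj, fun hh => h.notMem hh.2, fun hh => h.adj.ne hh.1.symm⟩

/-- Every edge of a tree is a bridge, and `detach` removes the edge from `u` to `w`. -/
theorem not_reachable_left {w : V} (hw : w ∈ W) : ¬(G.detach u W).Reachable u w := by
  have hb := isAcyclic_iff_forall_adj_isBridge.1 h.isTree.isAcyclic (h.adj_of_mem w hw)
  rw [isBridge_iff] at hb
  refine fun hr => hb (hr.mono fun x y hxy => ?_)
  rw [detach_adj] at hxy
  rw [deleteEdges_adj]
  refine ⟨hxy.1, fun he => ?_⟩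
  rcases Sym2.eq_iff.1 (Set.mem_singleton_iff.1 he) with ⟨rfl, rfl⟩ | ⟨rfl, rfl⟩
  · exact hxy.2.1 ⟨rfl, hw⟩
  · exact hxy.2.2 ⟨rfl, hw⟩

theorem not_reachable_right {w : V} (hw : w ∈ W) : ¬(G.detach u W).Reachable v w :=
  fun hr => h.not_reachable_left hw (h.detach_adj_left.reachable.trans hr)

theorem not_detach_adj_right {w : V} (hw : w ∈ W) : ¬(G.detach u W).Adj v w :=
  fun hr => h.not_reachable_right hw hr.reachable

theorem not_adj_right {w : V} (hw : w ∈ W) : ¬G.Adj v w := fun hr =>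
  h.not_detach_adj_right hw ⟨hr, fun hh => h.adj.ne hh.1.symm,
    fun hh => h.self_notMem (hh.1 ▸ hw)⟩

theorem ne_right {w : V} (hw : w ∈ W) : v ≠ w := fun hh => h.notMem (hh ▸ hw)

/-- A lost edge from `u` to `w` is replaced by the path through `v`. -/
theorem shift_connected : (G.shift u v W).Connected := by
  have key {x y : V} (hxy : G.Adj x y) : (G.shift u v W).Reachable x y := by
    have huv : (G.shift u v W).Adj u v := Or.inl h.detach_adj_left
    have hvw {w : V} (hw : w ∈ W) : (G.shift u v W).Adj v w :=
      Or.inr ⟨h.ne_right hw, Or.inl ⟨rfl, hw⟩⟩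
    by_cases h₁ : x = u ∧ y ∈ W
    · rw [h₁.1]
      exact huv.reachable.trans (hvw h₁.2).reachable
    by_cases h₂ : y = u ∧ x ∈ W
    · rw [h₂.1]
      exact (huv.reachable.trans (hvw h₂.2).reachable).symm
    exact Adj.reachable (Or.inl ⟨hxy, h₁, h₂⟩)
  have := h.isTree.connected.nonempty
  refine ⟨fun x y => ?_⟩
  obtain ⟨p⟩ := h.isTree.connected x y
  induction p with
  | nil => exact Reachable.refl _
  | cons hxy _ ih => exact (key hxy).trans ih

/-- The shift is connected and has no more edges than `G`: at most as many are added as were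
removed. -/
theorem shift_isTree [Finite V] : (G.shift u v W).IsTree := by
  refine isTree_iff_connected_and_card.2 ⟨h.shift_connected, le_antisymm ?_
    h.shift_connected.card_vert_le_card_edgeSet_add_one⟩
  rw [← (isTree_iff_connected_and_card.1 h.isTree).2, Nat.card_coe_set_eq, Nat.card_coe_set_eq]
  have inj (a : V) : Set.InjOn (fun w => s(a, w)) (W : Set V) := fun x _ y _ hxy =>
    Sym2.congr_right.1 hxy
  have h₁ : (G.shift u v W).edgeSet ⊆ (G.detach u W).edgeSet ∪ (fun w => s(v, w)) '' W := by
    intro e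
    induction e with
    | _ x y =>
      rw [mem_edgeSet, shift_adj]
      rintro (hxy | ⟨-, ⟨rfl, hy⟩ | ⟨rfl, hx⟩⟩)
      · exact Or.inl hxy
      · exact Or.inr ⟨y, hy, rfl⟩
      · exact Or.inr ⟨x, hx, Sym2.eq_swap⟩
  have h₂ : (G.detach u W).edgeSet ∪ (fun w => s(u, w)) '' W ⊆ G.edgeSet := by
    rintro e (he | ⟨w, hw, rfl⟩)
    · induction e with
      | _ x y => exact he.1
    · exact h.adj_of_mem w hw
  have hd : Disjoint (G.detach u W).edgeSet ((fun w => s(u, w)) '' W) := by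
    rw [Set.disjoint_left]
    rintro e he ⟨w, hw, rfl⟩
    exact he.2.1 ⟨rfl, hw⟩
  have e₁ := Set.ncard_le_ncard h₁ (Set.toFinite _)
  have e₂ := Set.ncard_le_ncard h₂ (Set.toFinite _)
  rw [Set.ncard_union_eq hd (Set.toFinite _) (Set.toFinite _), (inj u).ncard_image] at e₂
  have e₃ := Set.ncard_union_le (G.detach u W).edgeSet ((fun w => s(v, w)) '' (W : Set V))
  rw [(inj v).ncard_image] at e₃
  omega

theorem adjMatrix_eq_attach :
    G.adjMatrix ℝ = ((G.detach u W).adjMatrix ℝ).attach (fun x => if x ∈ W then 1 else 0) u := by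
  ext x y
  have hu := h.self_notMem
  have h₁ := h.adj_of_mem
  by_cases hx : x = u <;> by_cases hy : y = u <;> by_cases hxW : x ∈ W <;> by_cases hyW : y ∈ W <;>
    simp_all [Matrix.attach, adjMatrix_apply, detach_adj, G.adj_comm]

theorem adjMatrix_shift_eq_attach : (G.shift u v W).adjMatrix ℝ =
    ((G.detach u W).adjMatrix ℝ).attach (fun x => if x ∈ W then 1 else 0) v := by
  ext x y
  have hv := h.notMem
  have h₁ : ∀ w ∈ W, ¬(G.detach u W).Adj v w := fun w hw => h.not_detach_adj_right hw
  have h₂ : ∀ w ∈ W, ¬(G.detach u W).Adj w v := fun w hw hh => h.not_detach_adj_right hw hh.symm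
  have h₃ : ∀ w ∈ W, v ≠ w := fun w hw => h.ne_right hw
  by_cases hx : x = v <;> by_cases hy : y = v <;> by_cases hxW : x ∈ W <;> by_cases hyW : y ∈ W <;>
    simp_all [Matrix.attach, adjMatrix_apply, shift_adj, eq_comm (a := v)]

variable [Fintype V]

theorem degree_shift_of_ne {x : V} (hu : x ≠ u) (hv : x ≠ v) :
    (G.shift u v W).degree x = G.degree x := by
  by_cases hx : x ∈ W
  · have : (G.shift u v W).neighborFinset x = insert v ((G.neighborFinset x).erase u) := by
      ext y
      simp only [mem_neighborFinset, Finset.mem_insert, Finset.mem_erase, shift_adj, detach_adj]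
      constructor
      · rintro (⟨h₁, -, h₂⟩ | ⟨-, ⟨rfl, -⟩ | ⟨rfl, -⟩⟩)
        · exact Or.inr ⟨fun hy => h₂ ⟨hy, hx⟩, h₁⟩
        · exact absurd rfl hv
        · exact Or.inl rfl
      · rintro (rfl | ⟨h₁, h₂⟩)
        · exact Or.inr ⟨hv, Or.inr ⟨rfl, hx⟩⟩
        · exact Or.inl ⟨h₂, fun hh => hu hh.1, fun hh => h₁ hh.1⟩
    rw [← card_neighborFinset_eq_degree, this, Finset.card_insert_of_notMem,
      Finset.card_erase_add_one, card_neighborFinset_eq_degree]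
    · rw [mem_neighborFinset]
      exact (h.adj_of_mem x hx).symm
    · rw [Finset.mem_erase, mem_neighborFinset]
      exact fun hh => h.not_adj_right hx hh.2.symm
  · rw [← card_neighborFinset_eq_degree, ← card_neighborFinset_eq_degree]
    congr 1
    ext y
    simp only [mem_neighborFinset, shift_adj, detach_adj]
    constructor
    · rintro (⟨h₁, -, h₂⟩ | ⟨-, ⟨rfl, -⟩ | ⟨rfl, h₁⟩⟩)
      · exact h₁
      · exact absurd rfl hv
      · exact absurd h₁ hx
    · exact fun hh => Or.inl ⟨hh, fun h₁ => hu h₁.1, fun h₁ => hx h₁.2⟩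

theorem degree_shift_left_add : (G.shift u v W).degree u + W.card = G.degree u := by
  have : (G.shift u v W).neighborFinset u = G.neighborFinset u \ W := by
    ext y
    simp only [mem_neighborFinset, Finset.mem_sdiff, shift_adj, detach_adj]
    constructor
    · rintro (⟨h₁, h₂, -⟩ | ⟨-, ⟨h₁, -⟩ | ⟨-, h₁⟩⟩)
      · exact ⟨h₁, fun hy => h₂ ⟨trivial, hy⟩⟩
      · exact absurd h₁ h.adj.ne
      · exact absurd h₁ h.self_notMem
    · exact fun hh => Or.inl ⟨hh.1, fun h₁ => hh.2 h₁.2, fun h₁ => h.self_notMem h₁.2⟩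
  rw [← card_neighborFinset_eq_degree, this, ← card_neighborFinset_eq_degree,
    Finset.card_sdiff_add_card_eq_card]
  exact fun w hw => (mem_neighborFinset _ _ _).2 (h.adj_of_mem w hw)

theorem degree_shift_right : (G.shift u v W).degree v = G.degree v + W.card := by
  have : (G.shift u v W).neighborFinset v = G.neighborFinset v ∪ W := by
    ext y
    simp only [mem_neighborFinset, Finset.mem_union, shift_adj, detach_adj]
    constructor
    · rintro (⟨h₁, -⟩ | ⟨-, ⟨-, h₁⟩ | ⟨-, h₁⟩⟩)
      · exact Or.inl h₁
      · exact Or.inr h₁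
      · exact absurd h₁ h.notMem
    · rintro (hh | hh)
      · exact Or.inl ⟨hh, fun h₁ => h.adj.ne h₁.1.symm, fun h₁ => h.notMem h₁.2⟩
      · exact Or.inr ⟨h.ne_right hh, Or.inl ⟨trivial, hh⟩⟩
  rw [← card_neighborFinset_eq_degree, this, ← card_neighborFinset_eq_degree,
    Finset.card_union_of_disjoint]
  rw [Finset.disjoint_left]
  exact fun w h₁ h₂ => h.not_adj_right h₂ ((mem_neighborFinset _ _ _).1 h₁)

/-- Only the degrees of `u` and `v` change, and the sum of squares grows by 2|W|(deg v + |W| - deg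
u). -/
theorem sum_degree_sq_lt (hW : W.Nonempty) (hd : G.degree u < G.degree v + W.card) :
    ∑ x, G.degree x ^ 2 < ∑ x, (G.shift u v W).degree x ^ 2 := by
  have hv : v ∈ Finset.univ.erase u := Finset.mem_erase.2 ⟨h.adj.ne.symm, Finset.mem_univ _⟩
  rw [← Finset.add_sum_erase _ _ (Finset.mem_univ u), ← Finset.add_sum_erase _ _ hv,
    ← Finset.add_sum_erase _ (fun x => (G.shift u v W).degree x ^ 2) (Finset.mem_univ u),
    ← Finset.add_sum_erase _ _ hv]
  have hrest : ∑ x ∈ (Finset.univ.erase u).erase v, (G.shift u v W).degree x ^ 2 =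
      ∑ x ∈ (Finset.univ.erase u).erase v, G.degree x ^ 2 := by
    refine Finset.sum_congr rfl fun x hx => ?_
    simp only [Finset.mem_erase] at hx
    rw [h.degree_shift_of_ne hx.2.1 hx.1]
  rw [hrest, h.degree_shift_right]
  have h₁ := h.degree_shift_left_add
  have hc := hW.card_pos
  rw [← h₁] at hd ⊢
  have : (G.shift u v W).degree u < G.degree v := by omega
  nlinarith

end IsShiftable

theorem adjMatrix_pow_apply_eq_zero [Fintype V] {x y : V} (h : ¬G.Reachable x y) (k : ℕ) :
    (G.adjMatrix ℝ ^ k) x y = 0 := by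
  rw [adjMatrix_pow_apply_eq_card_walk, Nat.cast_eq_zero, Fintype.card_eq_zero_iff]
  exact ⟨fun p => h ⟨p.1⟩⟩

theorem adjMatrix_pow_apply_nonneg [Fintype V] (x y : V) (k : ℕ) :
    0 ≤ (G.adjMatrix ℝ ^ k) x y := by
  rw [adjMatrix_pow_apply_eq_card_walk]
  positivity

theorem adjMatrix_pow_apply_comm [Fintype V] (x y : V) (k : ℕ) :
    (G.adjMatrix ℝ ^ k) x y = (G.adjMatrix ℝ ^ k) y x := by
  have := (G.isSymm_adjMatrix (α := ℝ)).pow k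
  exact this.apply y x

theorem IsShiftable.spectralMoment_le [Fintype V] (h : G.IsShiftable u v W)
    (hle : ∀ k, ((G.detach u W).adjMatrix ℝ ^ k) u u ≤ ((G.detach u W).adjMatrix ℝ ^ k) v v)
    (k : ℕ) : G.spectralMoment k ≤ (G.shift u v W).spectralMoment k := by
  have mem {x : V} (hx : (if x ∈ W then (1 : ℝ) else 0) ≠ 0) : x ∈ W := by simpa using hx
  have e₁ := h.adjMatrix_eq_attach
  have e₂ := h.adjMatrix_shift_eq_attach
  unfold spectralMoment
  -- The eigenvalues depend on the proof of symmetry, which must be generalized before the matrices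
  -- can be rewritten.
  generalize_proofs h₁ h₂
  revert h₁ h₂
  rw [e₁, e₂]
  intro h₁ h₂
  refine Matrix.sum_eigenvalues_pow_attach_le ?_ ?_ ?_ ?_ ?_ ?_ hle h₁ h₂ k
  · intro x y
    rw [adjMatrix_apply]
    split_ifs <;> norm_num
  · intro x
    split_ifs <;> norm_num
  · exact fun x k hx => adjMatrix_pow_apply_eq_zero (h.not_reachable_left (mem hx)) k
  · exact fun x k hx => adjMatrix_pow_apply_eq_zero
      (fun hr => h.not_reachable_left (mem hx) hr.symm) k
  · exact fun x k hx => adjMatrix_pow_apply_eq_zero (h.not_reachable_right (mem hx)) k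
  · exact fun x k hx => adjMatrix_pow_apply_eq_zero
      (fun hr => h.not_reachable_right (mem hx) hr.symm) k

theorem adjMatrix_pow_succ_apply [Fintype V] (x y : V) (k : ℕ) :
    (G.adjMatrix ℝ ^ (k + 1)) x y = ∑ z ∈ G.neighborFinset x, (G.adjMatrix ℝ ^ k) z y := by
  rw [pow_succ', adjMatrix_mul_apply]

/-- Closed walks at a leaf are at most as many as closed walks at its neighbor. -/
theorem adjMatrix_pow_apply_self_le_of_leaf [Fintype V] (hu : ∀ x, G.Adj u x ↔ x = v) (k : ℕ) :
    (G.adjMatrix ℝ ^ k) u u ≤ (G.adjMatrix ℝ ^ k) v v := by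
  cases k with
  | zero => simp
  | succ k =>
    rw [adjMatrix_pow_succ_apply, adjMatrix_pow_succ_apply]
    have : G.neighborFinset u = {v} := by ext x; simp [hu]
    rw [this, Finset.sum_singleton, adjMatrix_pow_apply_comm]
    exact Finset.single_le_sum (f := fun z => (G.adjMatrix ℝ ^ k) z v)
      (fun z _ => adjMatrix_pow_apply_nonneg z v k)
      ((mem_neighborFinset _ _ _).2 ((hu v).2 rfl).symm)

/-- If `u` has exactly two neighbors, a leaf and `v`, and `v` is also adjacent to a leaf, then
closed walks at `u` are at most as many as closed walks at `v`. -/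
theorem adjMatrix_pow_apply_self_le_of_two_leaves [Fintype V] {u' v' : V} (huv' : u ≠ v')
    (hne : u' ≠ v) (hu : ∀ x, G.Adj u x ↔ x = u' ∨ x = v) (hu' : ∀ x, G.Adj u' x ↔ x = u)
    (hv' : ∀ x, G.Adj v' x ↔ x = v) (k : ℕ) :
    (G.adjMatrix ℝ ^ k) u u ≤ (G.adjMatrix ℝ ^ k) v v := by
  have nu : G.neighborFinset u = {u', v} := by ext x; simp [hu]
  have nu' : G.neighborFinset u' = {u} := by ext x; simp [hu']
  have nv' : G.neighborFinset v' = {v} := by ext x; simp [hv']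
  have nv : ({v', u} : Finset V) ⊆ G.neighborFinset v := by
    intro x hx
    rw [mem_neighborFinset]
    rcases Finset.mem_insert.1 hx with rfl | hx
    · exact ((hv' v).2 rfl).symm
    · rw [Finset.mem_singleton.1 hx]
      exact ((hu v).2 (Or.inr rfl)).symm
  -- The induction needs the walks that start at the leaves as well. A first step from `u` to `u'`
  -- or `v` is compared with one from `v` to `v'` or `u`; the mixed terms agree by symmetry.
  have key : (G.adjMatrix ℝ ^ k) u u ≤ (G.adjMatrix ℝ ^ k) v v ∧
      (G.adjMatrix ℝ ^ k) u' u ≤ (G.adjMatrix ℝ ^ k) v' v := by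
    induction k with
    | zero =>
      have : u' ≠ u := ((hu' u).2 rfl).ne
      have : v' ≠ v := ((hv' v).2 rfl).ne
      simp [*]
    | succ k ih =>
      simp only [adjMatrix_pow_succ_apply, nu, nu', nv', Finset.sum_singleton]
      refine ⟨?_, ih.1⟩
      refine le_trans ?_ (Finset.sum_le_sum_of_subset_of_nonneg nv
        fun z _ _ => adjMatrix_pow_apply_nonneg z v k)
      rw [Finset.sum_pair hne, Finset.sum_pair huv'.symm, adjMatrix_pow_apply_comm v u]
      exact add_le_add_left ih.2 _
  exact key.1

end SimpleGraph

end Shift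

/-! ### König's theorem for trees -/

section Koenig

open scoped Classical

namespace SimpleGraph

variable {V : Type*} {G : SimpleGraph V}

/-- In a tree, a vertex has only one neighbor that is closer to the root. -/
theorem IsTree.eq_of_adj_of_dist_add_one_eq (hG : G.IsTree) {r x p q : V} (hp : G.Adj p x)
    (hq : G.Adj q x) (hdp : G.dist r p + 1 = G.dist r x) (hdq : G.dist r q + 1 = G.dist r x) :
    p = q := by
  have path {p : V} (hp : G.Adj p x) (hdp : G.dist r p + 1 = G.dist r x) :
      ∃ P : G.Walk r x, P.IsPath ∧ P.penultimate = p := by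
    obtain ⟨P, hP⟩ := hG.connected.exists_walk_length_eq_dist r p
    refine ⟨P.concat hp, Walk.isPath_of_length_eq_dist _ ?_, by simp⟩
    rw [Walk.length_concat, hP, hdp]
  obtain ⟨P, hP, rfl⟩ := path hp hdp
  obtain ⟨Q, hQ, rfl⟩ := path hq hdq
  rw [Subtype.mk.inj ((hG.isAcyclic.subsingleton_path r x).elim ⟨P, hP⟩ ⟨Q, hQ⟩)]

/-- The map `f` pairs the vertices of `C` with vertices outside of `C` along disjoint edges. -/
structure IsMatchingMap (G : SimpleGraph V) (C : Finset V) (f : V → V) : Prop where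
  adj : ∀ c ∈ C, G.Adj c (f c)
  notMem : ∀ c ∈ C, f c ∉ C
  injOn : Set.InjOn f C

/-- **König's theorem** for the subgraph of a tree induced on a set of vertices. -/
theorem IsTree.exists_isMatchingMap_cover_on [Finite V] (hG : G.IsTree) (s : Finset V) :
    ∃ C f, G.IsMatchingMap C f ∧ C ⊆ s ∧ (∀ c ∈ C, f c ∈ s) ∧
      ∀ x ∈ s, ∀ y ∈ s, G.Adj x y → x ∈ C ∨ y ∈ C := by
  obtain ⟨r⟩ := hG.connected.nonempty
  induction s using Finset.strongInduction with
  | H s ih =>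
    let t := s.filter fun x => ∃ y ∈ s, G.Adj x y
    rcases t.eq_empty_or_nonempty with ht | ht
    · refine ⟨∅, id, ⟨by simp, by simp, by simp⟩, by simp, by simp, fun x hx y hy hxy => ?_⟩
      have : x ∈ t := Finset.mem_filter.2 ⟨hx, y, hy, hxy⟩
      simp [ht] at this
    -- In the graph induced on `s`, a non-isolated vertex farthest from the root has its parent `p`
    -- as only neighbor. Put `p` into the cover, the edge `px` into the matching, and delete both
    -- vertices.
    obtain ⟨x, hxt, hmax⟩ := t.exists_max_image (G.dist r) ht
    obtain ⟨hxs, p, hps, hxp⟩ := Finset.mem_filter.1 hxt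
    have hdist (y : V) (hy : y ∈ s) (hxy : G.Adj x y) : G.dist r y + 1 = G.dist r x := by
      have h₁ := hmax y (Finset.mem_filter.2 ⟨hy, x, hxs, hxy.symm⟩)
      rcases hG.dist_eq_dist_add_one_of_adj r hxy with h | h <;> omega
    have huniq (y : V) (hy : y ∈ s) (hxy : G.Adj x y) : y = p :=
      hG.eq_of_adj_of_dist_add_one_eq hxy.symm hxp.symm (hdist y hy hxy) (hdist p hps hxp)
    obtain ⟨C, f, hf, hCs, hfs, hC⟩ := ih ((s.erase x).erase p)
      ((Finset.erase_subset _ _).trans_ssubset (Finset.erase_ssubset hxs))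
    have hpC : p ∉ C := fun h => (Finset.mem_erase.1 (hCs h)).1 rfl
    have hxC : x ∉ C := fun h => (Finset.mem_erase.1 (Finset.mem_erase.1 (hCs h)).2).1 rfl
    have hne (c : V) (hc : c ∈ C) : c ≠ p := fun h => hpC (h ▸ hc)
    have hfp (c : V) (hc : c ∈ C) : f c ≠ p := (Finset.mem_erase.1 (hfs c hc)).1
    have hfx (c : V) (hc : c ∈ C) : f c ≠ x :=
      (Finset.mem_erase.1 (Finset.mem_erase.1 (hfs c hc)).2).1
    refine ⟨insert p C, Function.update f p x, ⟨?_, ?_, ?_⟩, ?_, ?_, ?_⟩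
    · intro c hc
      rcases Finset.mem_insert.1 hc with rfl | hc
      · simpa using hxp.symm
      · simpa [hne c hc] using hf.adj c hc
    · intro c hc
      rcases Finset.mem_insert.1 hc with rfl | hc
      · simpa [hxC] using hxp.ne
      · simpa [hne c hc, hfp c hc] using hf.notMem c hc
    · intro c hc d hd hcd
      rw [Finset.mem_coe, Finset.mem_insert] at hc hd
      rcases hc with rfl | hc <;> rcases hd with rfl | hd
      · rfl
      · simp only [Function.update_self, Function.update_of_ne (hne d hd)] at hcd
        exact absurd hcd.symm (hfx d hd)
      · simp only [Function.update_self, Function.update_of_ne (hne c hc)] at hcd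
        exact absurd hcd (hfx c hc)
      · simp only [Function.update_of_ne (hne c hc), Function.update_of_ne (hne d hd)] at hcd
        exact hf.injOn hc hd hcd
    · intro c hc
      rcases Finset.mem_insert.1 hc with rfl | hc
      · exact hps
      · exact Finset.mem_of_mem_erase (Finset.mem_of_mem_erase (hCs hc))
    · intro c hc
      rcases Finset.mem_insert.1 hc with rfl | hc
      · simpa using hxs
      · rw [Function.update_of_ne (hne c hc)]
        exact Finset.mem_of_mem_erase (Finset.mem_of_mem_erase (hfs c hc))
    · intro y hy z hz hyz
      simp only [Finset.mem_insert]
      by_cases hyp : y = p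
      · exact Or.inl (Or.inl hyp)
      by_cases hzp : z = p
      · exact Or.inr (Or.inl hzp)
      have hyx : y ≠ x := fun h => hzp (huniq z hz (h ▸ hyz))
      have hzx : z ≠ x := fun h => hyp (huniq y hy (h ▸ hyz.symm))
      exact (hC y (by simp [*]) z (by simp [*]) hyz).imp Or.inr Or.inr

/-- A matching as an involution that moves every matched vertex to its partner. -/
theorem IsMatchingMap.exists_involutive {C : Finset V} {f : V → V} (hf : G.IsMatchingMap C f) :
    ∃ m : V → V, (∀ x, m (m x) = x) ∧ (∀ x, m x = x ∨ G.Adj x (m x)) ∧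
      ∀ x, m x ≠ x ↔ x ∈ C ∪ C.image f := by
  have key (x : V) : ∃ y, (x ∈ C → y = f x) ∧ (∀ c ∈ C, f c = x → y = c) ∧
      (x ∉ C → x ∉ C.image f → y = x) := by
    by_cases hx : x ∈ C
    · exact ⟨f x, fun _ => rfl, fun c hc h => absurd (h ▸ hx) (hf.notMem c hc), fun h => absurd hx h⟩
    · by_cases hx' : x ∈ C.image f
      · obtain ⟨c, hc, rfl⟩ := Finset.mem_image.1 hx'
        exact ⟨c, fun h => absurd h hx, fun d hd h => (hf.injOn hd hc h).symm,
          fun _ h => absurd hx' h⟩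
      · exact ⟨x, fun h => absurd h hx,
          fun c hc h => absurd (Finset.mem_image.2 ⟨c, hc, h⟩) hx', fun _ _ => rfl⟩
  choose m h₁ h₂ h₃ using key
  refine ⟨m, fun x => ?_, fun x => ?_, fun x => ?_⟩ <;> by_cases hx : x ∈ C
  · rw [h₁ x hx]
    exact h₂ _ x hx rfl
  · by_cases hx' : x ∈ C.image f
    · obtain ⟨c, hc, rfl⟩ := Finset.mem_image.1 hx'
      rw [h₂ _ c hc rfl, h₁ c hc]
    · rw [h₃ x hx hx', h₃ x hx hx']
  · rw [h₁ x hx]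
    exact Or.inr (hf.adj x hx)
  · by_cases hx' : x ∈ C.image f
    · obtain ⟨c, hc, rfl⟩ := Finset.mem_image.1 hx'
      rw [h₂ _ c hc rfl]
      exact Or.inr (hf.adj c hc).symm
    · exact Or.inl (h₃ x hx hx')
  · simpa [hx, h₁ x hx] using (hf.adj x hx).ne.symm
  · by_cases hx' : x ∈ C.image f
    · refine iff_of_true ?_ (Finset.mem_union_right _ hx')
      obtain ⟨c, hc, rfl⟩ := Finset.mem_image.1 hx'
      rw [h₂ _ c hc rfl]
      exact (hf.adj c hc).ne
    · exact iff_of_false (not_not.2 (h₃ x hx hx')) (by rw [Finset.mem_union]; tauto)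

theorem IsMatchingMap.card_union_image {C : Finset V} {f : V → V} (hf : G.IsMatchingMap C f) :
    (C ∪ C.image f).card = 2 * C.card := by
  rw [Finset.card_union_of_disjoint, Finset.card_image_of_injOn hf.injOn, two_mul]
  rw [Finset.disjoint_right]
  intro x hx
  obtain ⟨c, hc, rfl⟩ := Finset.mem_image.1 hx
  exact hf.notMem c hc

theorem IsMatchingMap.exists_isMatching {C : Finset V} {f : V → V} (hf : G.IsMatchingMap C f) :
    ∃ M : G.Subgraph, M.IsMatching ∧ M.edgeSet.ncard = C.card := by
  let M : G.Subgraph :=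
    { verts := {x | x ∈ C ∨ ∃ c ∈ C, f c = x}
      Adj := fun x y => (x ∈ C ∧ f x = y) ∨ (y ∈ C ∧ f y = x)
      adj_sub := by
        rintro x y (⟨h, rfl⟩ | ⟨h, rfl⟩)
        · exact hf.adj x h
        · exact (hf.adj y h).symm
      edge_vert := by
        rintro x y (⟨h, rfl⟩ | ⟨h, rfl⟩)
        · exact Or.inl h
        · exact Or.inr ⟨y, h, rfl⟩
      symm := ⟨fun x y h => h.symm⟩ }
  refine ⟨M, ?_, ?_⟩
  · rintro x (hx | ⟨c, hc, rfl⟩)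
    · refine ⟨f x, Or.inl ⟨hx, rfl⟩, ?_⟩
      rintro y (⟨-, h⟩ | ⟨h, rfl⟩)
      · exact h.symm
      · exact absurd hx (hf.notMem y h)
    · refine ⟨c, Or.inr ⟨hc, rfl⟩, ?_⟩
      rintro y (⟨h, -⟩ | ⟨h, h'⟩)
      · exact absurd h (hf.notMem c hc)
      · exact hf.injOn h hc h'
  · have : M.edgeSet = (fun c => s(c, f c)) '' (C : Set V) := by
      ext e
      induction e with
      | _ x y =>
        rw [Subgraph.mem_edgeSet]
        constructor
        · rintro (⟨h, rfl⟩ | ⟨h, rfl⟩)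
          · exact ⟨x, h, rfl⟩
          · exact ⟨y, h, Sym2.eq_swap⟩
        · rintro ⟨c, hc, h⟩
          rcases Sym2.eq_iff.1 h with ⟨rfl, rfl⟩ | ⟨rfl, rfl⟩
          · exact Or.inl ⟨hc, rfl⟩
          · exact Or.inr ⟨hc, rfl⟩
    rw [this, Set.InjOn.ncard_image, Set.ncard_coe_finset]
    intro c hc d hd h
    rcases Sym2.eq_iff.1 h with ⟨h, -⟩ | ⟨h, -⟩
    · exact h
    · exact absurd (h ▸ hc) (hf.notMem d hd)

variable [Fintype V]

theorem IsTree.exists_isMatchingMap_cover (hG : G.IsTree) :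
    ∃ C f, G.IsMatchingMap C f ∧ ∀ x y, G.Adj x y → x ∈ C ∨ y ∈ C := by
  obtain ⟨C, f, hf, -, -, hC⟩ := hG.exists_isMatchingMap_cover_on Finset.univ
  exact ⟨C, f, hf, fun x y => hC x (Finset.mem_univ _) y (Finset.mem_univ _)⟩

/-- Each matching edge has an endpoint outside the independent set, and disjoint edges yield
distinct endpoints. -/
theorem Subgraph.IsMatching.card_add_ncard_edgeSet_le {M : G.Subgraph} (hM : M.IsMatching)
    {s : Finset V} (hs : G.IsIndepSet (s : Set V)) :
    s.card + M.edgeSet.ncard ≤ Fintype.card V := by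
  have key (e : Sym2 V) : ∃ x, e ∈ M.edgeSet → x ∈ e ∧ x ∉ s := by
    induction e with
    | _ x y =>
      by_cases hx : x ∈ s
      · refine ⟨y, fun he => ⟨Sym2.mem_mk_right _ _, fun hy => ?_⟩⟩
        have hadj : G.Adj x y := M.adj_sub he
        exact hs hx hy hadj.ne hadj
      · exact ⟨x, fun _ => ⟨Sym2.mem_mk_left _ _, hx⟩⟩
  choose g hg using key
  have h₁ : M.edgeSet.ncard ≤ ((sᶜ : Finset V) : Set V).ncard := by
    refine Set.ncard_le_ncard_of_injOn g (fun e he => by simpa using (hg e he).2) ?_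
      (Set.toFinite _)
    intro e he e' he' heq
    obtain ⟨y, hy⟩ := Sym2.mem_iff_exists.1 (hg e he).1
    obtain ⟨z, hz⟩ := Sym2.mem_iff_exists.1 (hg e' he').1
    have h₁ : M.Adj (g e) y := by rwa [← Subgraph.mem_edgeSet, ← hy]
    have h₂ : M.Adj (g e) z := by rwa [heq, ← Subgraph.mem_edgeSet, ← hz]
    rw [hy, hz, ← heq, (hM (M.edge_vert h₁)).unique h₁ h₂]
  rw [Set.ncard_coe_finset, Finset.card_compl] at h₁
  have := s.card_le_univ
  omega

theorem bddAbove_card_matching (G : SimpleGraph V) :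
    BddAbove {m | ∃ M : G.Subgraph, M.IsMatching ∧ M.edgeSet.ncard = m} := by
  refine ⟨Fintype.card V, ?_⟩
  rintro m ⟨M, hM, rfl⟩
  simpa using hM.card_add_ncard_edgeSet_le (s := ∅) (by simp)

theorem exists_isMatching_ncard_eq_matchingNum (G : SimpleGraph V) :
    ∃ M : G.Subgraph, M.IsMatching ∧ M.edgeSet.ncard = G.matchingNum :=
  Nat.sSup_mem (s := {m | ∃ M : G.Subgraph, M.IsMatching ∧ M.edgeSet.ncard = m})
    ⟨0, ⊥, fun v hv => hv.elim, by simp⟩ G.bddAbove_card_matching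

theorem IsMatchingMap.card_le_matchingNum {C : Finset V} {f : V → V}
    (hf : G.IsMatchingMap C f) : C.card ≤ G.matchingNum :=
  le_csSup G.bddAbove_card_matching hf.exists_isMatching

theorem indepNum_add_matchingNum_le (G : SimpleGraph V) :
    G.indepNum + G.matchingNum ≤ Fintype.card V := by
  obtain ⟨M, hM, hMc⟩ := G.exists_isMatching_ncard_eq_matchingNum
  obtain ⟨s, hs⟩ := G.exists_isNIndepSet_indepNum
  rw [← hMc, ← hs.card_eq]
  exact hM.card_add_ncard_edgeSet_le hs.isIndepSet

/-- The complement of the cover is independent, which matches the general upper bound on the sum of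
both numbers. -/
theorem IsTree.exists_isMatchingMap_card (hG : G.IsTree) :
    ∃ C f, G.IsMatchingMap C f ∧ C.card + G.indepNum = Fintype.card V ∧
      G.matchingNum = C.card := by
  obtain ⟨C, f, hf, hC⟩ := hG.exists_isMatchingMap_cover
  have h₁ := hf.card_le_matchingNum
  have h₂ : G.IsIndepSet ((Cᶜ : Finset V) : Set V) := by
    intro x hx y hy _ hxy
    simp only [Finset.coe_compl, Set.mem_compl_iff, Finset.mem_coe] at hx hy
    exact (hC x y hxy).elim hx hy
  have h₃ := h₂.card_le_indepNum
  rw [Finset.card_compl] at h₃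
  have h₄ := G.indepNum_add_matchingNum_le
  have h₅ := C.card_le_univ
  exact ⟨C, f, hf, by omega, by omega⟩

theorem IsTree.indepNum_add_matchingNum (hG : G.IsTree) :
    G.indepNum + G.matchingNum = Fintype.card V := by
  obtain ⟨C, f, -, h₁, h₂⟩ := hG.exists_isMatchingMap_card
  omega

end SimpleGraph

end Koenig

/-! ### Spiders and their classification up to isomorphism -/

section Spider

open scoped Classical

namespace SimpleGraph

variable {V : Type*} {G : SimpleGraph V} {r : V}

theorem Connected.mem_of_forall_adj (hG : G.Connected) {S : Set V} (hr : r ∈ S)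
    (hS : ∀ x ∈ S, ∀ y, G.Adj x y → y ∈ S) (x : V) : x ∈ S := by
  obtain ⟨p⟩ := hG r x
  induction p with
  | nil => exact hr
  | cons h _ ih => exact ih (hS _ hr _ h)

/-- A connected graph consisting of paths of length at most two that start at `r` and are disjoint
otherwise. -/
structure IsSpider (G : SimpleGraph V) (r : V) : Prop where
  connected : G.Connected
  eq_of_adj : ∀ x y, G.Adj r x → G.Adj x y → y ≠ r →
    (∀ z, G.Adj y z → z = x) ∧ ∀ z, G.Adj x z → z ≠ r → z = y

/-- The neighbors of `r` that have another neighbor. -/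
def longLegs (G : SimpleGraph V) (r : V) : Set V := {x | G.Adj r x ∧ ∃ y, G.Adj x y ∧ y ≠ r}

/-- The neighbors of `r` that have no other neighbor. -/
def shortLegs (G : SimpleGraph V) (r : V) : Set V := {x | G.Adj r x ∧ ∀ y, G.Adj x y → y = r}

/-- The adjacency of a vertex of a spider to a vertex that is farther away from the center. -/
def spiderRel (ι κ : Type*) : Option ((ι × Bool) ⊕ κ) → Option ((ι × Bool) ⊕ κ) → Prop
  | none, some (.inl (_, false)) => True
  | none, some (.inr _) => True
  | some (.inl (i, false)), some (.inl (j, true)) => i = j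
  | _, _ => False

/-- The spider with legs of length two indexed by `ι` and legs of length one indexed by `κ`. -/
def spider (ι κ : Type*) : SimpleGraph (Option ((ι × Bool) ⊕ κ)) :=
  fromRel (spiderRel ι κ)

namespace IsSpider

theorem nonempty_iso_longLegs_shortLegs (h : G.IsSpider r) :
    Nonempty (spider (G.longLegs r) (G.shortLegs r) ≃g G) := by
  have hc (d : G.longLegs r) : ∃ y, G.Adj d y ∧ y ≠ r := d.2.2
  choose c hc hcr using hc
  have hcd (d : G.longLegs r) (z : V) : G.Adj (c d) z ↔ z = d :=
    ⟨(h.eq_of_adj d _ d.2.1 (hc d) (hcr d)).1 z, fun hz => hz ▸ (hc d).symm⟩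
  have hd (d : G.longLegs r) (z : V) : G.Adj d z ↔ z = r ∨ z = c d :=
    ⟨fun hz => or_iff_not_imp_left.2 ((h.eq_of_adj d _ d.2.1 (hc d) (hcr d)).2 z hz),
      fun hz => hz.elim (fun hz => hz ▸ d.2.1.symm) fun hz => hz ▸ hc d⟩
  have he (e : G.shortLegs r) (z : V) : G.Adj e z ↔ z = r :=
    ⟨e.2.2 z, fun hz => hz ▸ e.2.1.symm⟩
  have hdr (d : G.longLegs r) : (d : V) ≠ r := d.2.1.ne.symm
  have her (e : G.shortLegs r) : (e : V) ≠ r := e.2.1.ne.symm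
  have hdc (d d' : G.longLegs r) : (d : V) ≠ c d' := fun hh => by
    have := (hcd d' r).1 (hh ▸ d.2.1.symm)
    exact hdr d' this.symm
  have hec (e : G.shortLegs r) (d : G.longLegs r) : (e : V) ≠ c d := fun hh => by
    have := (hcd d r).1 (hh ▸ e.2.1.symm)
    exact hdr d this.symm
  have hde (d : G.longLegs r) (e : G.shortLegs r) : (d : V) ≠ e := fun hh => by
    exact hcr d (e.2.2 _ (hh ▸ hc d))
  have hcc (d d' : G.longLegs r) (hh : c d = c d') : d = d' :=
    Subtype.ext ((hcd d' d).1 (hh ▸ (hc d).symm))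
  let φ : Option ((G.longLegs r × Bool) ⊕ G.shortLegs r) → V := fun x =>
    match x with
    | none => r
    | some (.inl (d, false)) => d
    | some (.inl (d, true)) => c d
    | some (.inr e) => e
  have inj : Function.Injective φ := by
    rintro (_ | ⟨d, _ | _⟩ | e) (_ | ⟨d', _ | _⟩ | e') hh <;> simp only [φ] at hh
    · rfl
    · exact absurd hh.symm (hdr d')
    · exact absurd hh.symm (hcr d')
    · exact absurd hh.symm (her e')
    · exact absurd hh (hdr d)
    · rw [Subtype.ext hh]
    · exact absurd hh (hdc d d')
    · exact absurd hh (hde d e')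
    · exact absurd hh (hcr d)
    · exact absurd hh.symm (hdc d' d)
    · rw [hcc d d' hh]
    · exact absurd hh.symm (hec e' d)
    · exact absurd hh (her e)
    · exact absurd hh.symm (hde d' e)
    · exact absurd hh (hec e d')
    · rw [Subtype.ext hh]
  -- The image contains the center and is closed under adjacency, so connectedness makes it
  -- everything.
  have surj : Function.Surjective φ := by
    refine h.connected.mem_of_forall_adj (r := r) ⟨none, rfl⟩ ?_
    rintro _ ⟨_ | ⟨d, _ | _⟩ | e, rfl⟩ y hy
    · by_cases hl : ∃ z, G.Adj y z ∧ z ≠ r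
      · exact ⟨some (.inl (⟨y, hy, hl⟩, false)), rfl⟩
      · push Not at hl
        exact ⟨some (.inr ⟨y, hy, hl⟩), rfl⟩
    · rcases (hd d y).1 hy with rfl | rfl
      · exact ⟨none, rfl⟩
      · exact ⟨some (.inl (d, true)), rfl⟩
    · rw [(hcd d y).1 hy]
      exact ⟨some (.inl (d, false)), rfl⟩
    · rw [(he e y).1 hy]
      exact ⟨none, rfl⟩
  suffices hadj : ∀ p q, G.Adj (φ p) (φ q) ↔ (spider (G.longLegs r) (G.shortLegs r)).Adj p q from
    ⟨⟨Equiv.ofBijective φ ⟨inj, surj⟩, hadj _ _⟩⟩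
  rintro (_ | ⟨d, _ | _⟩ | e) (_ | ⟨d', _ | _⟩ | e') <;>
    simp only [φ, spider, spiderRel, fromRel_adj]
  · simp
  · simpa using d'.2.1
  · simpa [G.adj_comm r, hcd] using (hdr d').symm
  · simpa using e'.2.1
  · simpa using d.2.1.symm
  · simp [hd, hdr, hdc]
  · simp only [hd, hcr, false_or]
    refine ⟨fun hh => ⟨by simp, Or.inl (hcc _ _ hh).symm⟩, ?_⟩
    rintro ⟨-, hh | hh⟩
    · rw [hh]
    · exact hh.elim
  · simp [hd, her, hec]
  · simpa [hcd] using (hdr d).symm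
  · simp only [hcd]
    refine ⟨fun hh => ⟨by simp, Or.inr (Subtype.ext hh)⟩, ?_⟩
    rintro ⟨-, hh | hh⟩
    · exact hh.elim
    · rw [hh]
  · simp [hcd, (hdc _ _).symm]
  · simp [hcd, (hde _ _).symm]
  · simpa using e.2.1.symm
  · simp [he, hdr]
  · simp [he, hcr]
  · simp [he, her]

end IsSpider

/-- Spiders with equinumerous sets of legs are isomorphic. -/
def spiderCongr {ι κ ι' κ' : Type*} (e : ι ≃ ι') (f : κ ≃ κ') : spider ι κ ≃g spider ι' κ' where
  toEquiv := Equiv.optionCongr (Equiv.sumCongr (Equiv.prodCongr e (Equiv.refl Bool)) f)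
  map_rel_iff' := by
    rintro (_ | ⟨d, _ | _⟩ | e) (_ | ⟨d', _ | _⟩ | e') <;> simp [spider, spiderRel]

theorem IsSpider.nonempty_iso [Fintype V] (h : G.IsSpider r) {a b : ℕ}
    (ha : (G.longLegs r).ncard = a) (hV : Fintype.card V = 1 + 2 * a + b) :
    Nonempty (G ≃g spider (Fin a) (Fin b)) := by
  obtain ⟨e⟩ := h.nonempty_iso_longLegs_shortLegs
  have ha' : Fintype.card (G.longLegs r) = a := by
    rw [← ha, ← Nat.card_eq_fintype_card, Nat.card_coe_set_eq]
  have hb : Fintype.card (G.shortLegs r) = b := by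
    have := Fintype.card_congr e.toEquiv
    simp only [Fintype.card_option, Fintype.card_sum, Fintype.card_prod, Fintype.card_bool] at this
    omega
  exact ⟨e.symm.trans (spiderCongr (Fintype.equivFinOfCardEq ha') (Fintype.equivFinOfCardEq hb))⟩

end SimpleGraph

end Spider

/-! ### Improving a tree with a fixed matching until it is a spider -/

section Improve

open scoped Classical

namespace SimpleGraph

variable {V : Type*} {G : SimpleGraph V} {u v : V}

/-- The involution `m` is a matching: it moves every matched vertex to its partner. -/
structure IsMatchingInvolution (G : SimpleGraph V) (m : V → V) : Prop where
  involutive : ∀ x, m (m x) = x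
  eq_or_adj : ∀ x, m x = x ∨ G.Adj x (m x)

/-- Only edges between `u` and `W` disappear, so the matching survives as soon as the partner of `u`
is not moved. -/
theorem IsMatchingInvolution.shift {m : V → V} (hm : G.IsMatchingInvolution m) {W : Finset V}
    (hu : m u ∉ W) : (G.shift u v W).IsMatchingInvolution m := by
  refine ⟨hm.involutive, fun x => (hm.eq_or_adj x).imp_right fun hx => Or.inl ⟨hx, ?_, ?_⟩⟩
  · rintro ⟨rfl, h⟩
    exact hu h
  · rintro ⟨h, hW⟩
    rw [← h, hm.involutive] at hu
    exact hu hW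

variable [Fintype V]

theorem eq_of_adj_of_degree_le_one {x y z : V} (hx : G.degree x ≤ 1) (hy : G.Adj x y)
    (hz : G.Adj x z) : y = z := by
  rw [← card_neighborFinset_eq_degree] at hx
  exact Finset.card_le_one.1 hx y ((mem_neighborFinset _ _ _).2 hy) z
    ((mem_neighborFinset _ _ _).2 hz)

/-- The tree `G'` contains the matching `m`, its spectral moments are not smaller than those of
`G`, and it has a larger sum of squares of degrees. -/
structure IsImprovement (G G' : SimpleGraph V) (m : V → V) : Prop where
  isTree : G'.IsTree
  isMatchingInvolution : G'.IsMatchingInvolution m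
  spectralMoment_le : ∀ k, G.spectralMoment k ≤ G'.spectralMoment k
  sum_degree_sq_lt : ∑ x, G.degree x ^ 2 < ∑ x, G'.degree x ^ 2

/-- Moving all neighbors of `u` except `v` turns `u` into a leaf at `v`, so already after detaching
`adjMatrix_pow_apply_self_le_of_leaf` applies. -/
theorem IsTree.exists_isImprovement_of_adj (hG : G.IsTree) {m : V → V}
    (hm : G.IsMatchingInvolution m) (huv : G.Adj u v) (hu : 2 ≤ G.degree u)
    (hv : 2 ≤ G.degree v) (hmu : m u = u ∨ m u = v) : ∃ G', G.IsImprovement G' m := by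
  let W := (G.neighborFinset u).erase v
  have hW : W.card + 1 = G.degree u := by
    rw [Finset.card_erase_add_one ((mem_neighborFinset _ _ _).2 huv),
      card_neighborFinset_eq_degree]
  have hs : G.IsShiftable u v W :=
    ⟨hG, huv, fun w hw => (mem_neighborFinset _ _ _).1 (Finset.mem_of_mem_erase hw), by simp [W]⟩
  refine ⟨_, hs.shift_isTree, hm.shift ?_, hs.spectralMoment_le ?_,
    hs.sum_degree_sq_lt (Finset.card_pos.1 (by omega)) (by omega)⟩
  · rcases hmu with h | h <;> simp [W, h]
  · refine adjMatrix_pow_apply_self_le_of_leaf fun x => ⟨fun hx => ?_, ?_⟩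
    · by_contra hne
      exact hx.2.1 ⟨rfl, by simp [W, hne, hx.1]⟩
    · rintro rfl
      exact hs.detach_adj_left

/-- All neighbors of `u` move except `v` and the leaf `m u`. In the detached graph `v` still has its
leaf `m v`, so closed walks at `u` are dominated by those at `v`. -/
theorem IsTree.exists_isImprovement_of_leaves (hG : G.IsTree) {m : V → V}
    (hm : G.IsMatchingInvolution m) (huv : G.Adj u v) (hu : 3 ≤ G.degree u)
    (hv : 3 ≤ G.degree v) (hmu : G.Adj u (m u)) (hmv : G.Adj v (m v))
    (hmu' : G.degree (m u) ≤ 1) (hmv' : G.degree (m v) ≤ 1) (hne : m u ≠ v) :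
    ∃ G', G.IsImprovement G' m := by
  let W := ((G.neighborFinset u).erase v).erase (m u)
  have hW : W.card + 1 + 1 = G.degree u := by
    rw [Finset.card_erase_add_one, Finset.card_erase_add_one ((mem_neighborFinset _ _ _).2 huv),
      card_neighborFinset_eq_degree]
    exact Finset.mem_erase.2 ⟨hne, (mem_neighborFinset _ _ _).2 hmu⟩
  have hs : G.IsShiftable u v W :=
    ⟨hG, huv, fun w hw => (mem_neighborFinset _ _ _).1
      (Finset.mem_of_mem_erase (Finset.mem_of_mem_erase hw)), by simp [W]⟩
  have hvu : m v ≠ u := fun h => hne (by rw [← h, hm.involutive])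
  have hmuW : m u ∉ W := by simp [W]
  refine ⟨_, hs.shift_isTree, hm.shift hmuW, hs.spectralMoment_le ?_,
    hs.sum_degree_sq_lt (Finset.card_pos.1 (by omega)) (by omega)⟩
  refine adjMatrix_pow_apply_self_le_of_two_leaves (u' := m u) (v' := m v) hvu.symm hne
    (fun x => ⟨fun hx => ?_, ?_⟩) (fun x => ⟨fun hx => ?_, ?_⟩) (fun x => ⟨fun hx => ?_, ?_⟩)
  · by_contra! hh
    exact hx.2.1 ⟨rfl, by simp [W, hh, hx.1]⟩
  · rintro (rfl | rfl)
    · exact ⟨hmu, fun h => hmuW h.2, fun h => hmu.ne h.1.symm⟩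
    · exact hs.detach_adj_left
  · exact eq_of_adj_of_degree_le_one hmu' hx.1 hmu.symm
  · rintro rfl
    exact ⟨hmu.symm, fun h => hmu.ne h.1.symm, fun h => hmuW h.2⟩
  · exact eq_of_adj_of_degree_le_one hmv' hx.1 hmv.symm
  · rintro rfl
    refine ⟨hmv.symm, fun h => hvu h.1, fun h => huv.ne h.1.symm⟩

/-- The center is a vertex of maximal degree. The first kind of move being impossible, every vertex
of degree at least 2 is matched to a leaf; the second then limits non-leaf neighbors of the center
to degree 2. The matching edges are those at the center and at the long legs. -/
theorem IsTree.exists_isSpider_of_forall_not_isImprovement (hG : G.IsTree) {m : V → V}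
    (hm : G.IsMatchingInvolution m) {C : Finset V} (hC : ∀ x, m x ≠ x ↔ x ∈ C)
    (hne : C.Nonempty) (hmax : ∀ G', ¬G.IsImprovement G' m) :
    ∃ r, G.IsSpider r ∧ C.card = 2 * ((G.longLegs r).ncard + 1) := by
  have hadj {x : V} (hx : m x ≠ x) : G.Adj x (m x) := (hm.eq_or_adj x).resolve_left hx
  have h₁ {u v : V} (huv : G.Adj u v) (hu : 2 ≤ G.degree u) (hmu : m u = u ∨ m u = v) :
      G.degree v ≤ 1 := by
    by_contra! hv
    obtain ⟨G', h⟩ := hG.exists_isImprovement_of_adj hm huv hu hv hmu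
    exact hmax G' h
  have two_le {x y z : V} (hy : G.Adj x y) (hz : G.Adj x z) (hyz : y ≠ z) : 2 ≤ G.degree x := by
    by_contra! h
    exact hyz (eq_of_adj_of_degree_le_one (by omega) hy hz)
  obtain ⟨y₀, hy₀⟩ := hne
  rw [← hC] at hy₀
  -- Around an unmatched vertex of degree at least 2 all neighbors would be leaves. The tree would
  -- be a star with unmatched center, which leaves no room for the matched vertex `y₀`.
  have matched {x : V} (hx : 2 ≤ G.degree x) : m x ≠ x := by
    intro hmx
    have hnb {y : V} (hy : G.Adj x y) : G.degree y ≤ 1 := h₁ hy hx (Or.inl hmx)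
    have hall : y₀ = x ∨ G.Adj x y₀ := by
      refine hG.connected.mem_of_forall_adj (r := x) (S := {y | y = x ∨ G.Adj x y}) (Or.inl rfl)
        ?_ y₀
      rintro y (rfl | hy) z hz
      · exact Or.inr hz
      · exact Or.inl (eq_of_adj_of_degree_le_one (hnb hy) hz hy.symm)
    rcases hall with rfl | hxy
    · exact hy₀ hmx
    · have h : m y₀ = x := eq_of_adj_of_degree_le_one (hnb hxy) (hadj hy₀) hxy.symm
      rw [← h, hm.involutive] at hmx
      exact hy₀ hmx.symm
  have leaf {x : V} (hx : 2 ≤ G.degree x) : G.degree (m x) ≤ 1 :=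
    h₁ (hadj (matched hx)) hx (Or.inr rfl)
  have := hG.connected.nonempty
  obtain ⟨r, -, hr⟩ := Finset.univ.exists_max_image (fun x => G.degree x) Finset.univ_nonempty
  have hleg {x y : V} (hx : G.Adj r x) (hy : G.Adj x y) (hyr : y ≠ r) :
      2 ≤ G.degree x ∧ 2 ≤ G.degree r ∧ m r ≠ x ∧ m x ≠ r ∧ y = m x := by
    have hx2 := two_le hx.symm hy hyr.symm
    have hr2 := hx2.trans (hr x (Finset.mem_univ _))
    have hmr : m r ≠ x := by
      intro h
      have := leaf hr2
      rw [h] at this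
      omega
    have hmx : m x ≠ r := fun h => hmr (by rw [← h, hm.involutive])
    refine ⟨hx2, hr2, hmr, hmx, ?_⟩
    have hx3 : G.degree x ≤ 2 := by
      by_contra! h
      obtain ⟨G', h'⟩ := hG.exists_isImprovement_of_leaves hm hx
        (h.trans_le (hr x (Finset.mem_univ _))) h (hadj (matched hr2)) (hadj (matched hx2))
        (leaf hr2) (leaf hx2) hmr
      exact hmax G' h'
    by_contra hne
    have hsub : ({r, m x, y} : Finset V) ⊆ G.neighborFinset x := by
      intro z hz
      rw [mem_neighborFinset]
      simp only [Finset.mem_insert, Finset.mem_singleton] at hz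
      rcases hz with rfl | rfl | rfl
      exacts [hx.symm, hadj (matched hx2), hy]
    have := Finset.card_le_card hsub
    rw [card_neighborFinset_eq_degree, Finset.card_eq_three.2
      ⟨r, m x, y, hmx.symm, hyr.symm, Ne.symm hne, rfl⟩] at this
    omega
  refine ⟨r, ⟨hG.connected, fun x y hx hy hyr => ?_⟩, ?_⟩
  · obtain ⟨hx2, -, -, -, rfl⟩ := hleg hx hy hyr
    exact ⟨fun z hz => eq_of_adj_of_degree_le_one (leaf hx2) hz hy.symm,
      fun z hz hzr => (hleg hx hz hzr).2.2.2.2⟩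
  -- If the maximal degree is at most 1, the tree is the single edge from `y₀` to its partner.
  have hrm : m r ≠ r := by
    by_cases hr2 : 2 ≤ G.degree r
    · exact matched hr2
    have hle (x : V) : G.degree x ≤ 1 := (hr x (Finset.mem_univ _)).trans (by omega)
    have hall : r = y₀ ∨ r = m y₀ := by
      refine hG.connected.mem_of_forall_adj (r := y₀) (S := {y | y = y₀ ∨ y = m y₀}) (Or.inl rfl)
        ?_ r
      rintro y (rfl | rfl) z hz
      · exact Or.inr (eq_of_adj_of_degree_le_one (hle _) hz (hadj hy₀))
      · exact Or.inl (eq_of_adj_of_degree_le_one (hle _) hz (hadj hy₀).symm)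
    rcases hall with rfl | rfl
    · exact hy₀
    · rw [hm.involutive]
      exact hy₀.symm
  -- `N` contains one endpoint of each matching edge, so the matched vertices are `N` together with
  -- its disjoint image under `m`.
  let N : Finset V := insert r (G.longLegs r).toFinset
  have hN : N.card = (G.longLegs r).ncard + 1 := by
    rw [Finset.card_insert_of_notMem, Set.ncard_eq_toFinset_card']
    rw [Set.mem_toFinset]
    exact fun h => h.1.ne rfl
  have hNmem (x : V) : x ∈ N ↔ x = r ∨ x ∈ G.longLegs r := by simp [N]
  have hinj : Function.Injective m := Function.LeftInverse.injective hm.involutive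
  have hdisj : Disjoint N (N.image m) := by
    rw [Finset.disjoint_right]
    intro z hz hzN
    obtain ⟨x, hx, rfl⟩ := Finset.mem_image.1 hz
    rcases (hNmem x).1 hx with rfl | ⟨hx, y, hy, hyr⟩ <;>
      rcases (hNmem _).1 hzN with h | ⟨hx', y', hy', hyr'⟩
    · exact hrm h
    · exact (hleg hx' hy' hyr').2.2.1 rfl
    · exact (hleg hx hy hyr).2.2.2.1 h
    · have h₂ := (hleg hx' hy' hyr').1
      have h₃ := leaf (hleg hx hy hyr).1
      omega
  have hCN : C = N ∪ N.image m := by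
    ext x
    rw [← hC, Finset.mem_union, Finset.mem_image]
    constructor
    · intro hx
      have hall : x = r ∨ G.Adj r x ∨ ∃ y ∈ G.longLegs r, x = m y := by
        refine hG.connected.mem_of_forall_adj (r := r)
          (S := {x | x = r ∨ G.Adj r x ∨ ∃ y ∈ G.longLegs r, x = m y}) (Or.inl rfl) ?_ x
        rintro y (rfl | hy | ⟨y, ⟨hy, w, hw, hwr⟩, rfl⟩) z hz
        · exact Or.inr (Or.inl hz)
        · by_cases hzr : z = r
          · exact Or.inl hzr
          · exact Or.inr (Or.inr ⟨y, ⟨hy, z, hz, hzr⟩, (hleg hy hz hzr).2.2.2.2⟩)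
        · have h2 := (hleg hy hw hwr).1
          rw [eq_of_adj_of_degree_le_one (leaf h2) hz (hadj (matched h2)).symm]
          exact Or.inr (Or.inl hy)
      rcases hall with rfl | hrx | ⟨y, hy, rfl⟩
      · exact Or.inl ((hNmem _).2 (Or.inl rfl))
      · by_cases hl : x ∈ G.longLegs r
        · exact Or.inl ((hNmem _).2 (Or.inr hl))
        · have : m x = r := by
            by_contra h
            exact hl ⟨hrx, m x, hadj hx, h⟩
          exact Or.inr ⟨r, (hNmem _).2 (Or.inl rfl), by rw [← this, hm.involutive]⟩
      · exact Or.inr ⟨y, (hNmem _).2 (Or.inr hy), rfl⟩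
    · have hmN {x : V} (hx : x ∈ N) : m x ≠ x := by
        rcases (hNmem x).1 hx with rfl | ⟨hx, y, hy, hyr⟩
        · exact hrm
        · exact matched (hleg hx hy hyr).1
      rintro (hx | ⟨y, hy, rfl⟩)
      · exact hmN hx
      · rw [hm.involutive]
        exact (hmN hy).symm
  rw [hCN, Finset.card_union_of_disjoint hdisj, Finset.card_image_of_injective _ hinj, hN, two_mul]

/-- Every tree with a matching is dominated by a spider with a matching of the same size whose legs
of length two, together with the center, correspond to the matching edges. -/
theorem IsTree.exists_isSpider_spectralMoment_le (hG : G.IsTree) {m : V → V}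
    (hm : G.IsMatchingInvolution m) {C : Finset V} (hC : ∀ x, m x ≠ x ↔ x ∈ C)
    (hne : C.Nonempty) :
    ∃ (G' : SimpleGraph V) (r : V), G'.IsSpider r ∧ C.card = 2 * ((G'.longLegs r).ncard + 1) ∧
      ∀ k, G.spectralMoment k ≤ G'.spectralMoment k := by
  -- The bounded sum of squared degrees makes the sequence of improvements finite.
  have bound (H : SimpleGraph V) :
      ∑ x, H.degree x ^ 2 ≤ Fintype.card V * Fintype.card V ^ 2 := by
    rw [← Finset.card_univ, ← smul_eq_mul]
    exact Finset.sum_le_card_nsmul _ _ _ fun x _ =>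
      Nat.pow_le_pow_left (H.degree_lt_card_verts x).le 2
  induction hN : Fintype.card V * Fintype.card V ^ 2 - ∑ x, G.degree x ^ 2
    using Nat.strong_induction_on generalizing G with
  | _ N ih =>
    by_cases h : ∃ G', G.IsImprovement G' m
    · obtain ⟨G', h⟩ := h
      obtain ⟨G'', r, h₁, h₂, h₃⟩ := ih _ (by
        have := h.sum_degree_sq_lt
        have := bound G'
        omega) h.isTree h.isMatchingInvolution rfl
      exact ⟨G'', r, h₁, h₂, fun k => (h.spectralMoment_le k).trans (h₃ k)⟩
    · push Not at h
      obtain ⟨r, h₁, h₂⟩ := hG.exists_isSpider_of_forall_not_isImprovement hm hC hne h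
      exact ⟨G, r, h₁, h₂, fun k => le_rfl⟩

end SimpleGraph

end Improve

/-! ### Isomorphism invariance, degrees and levels of spiders -/

section SpiderGraph

open scoped Classical

theorem Multiset.sort_coe_of_pairwise {l : List ℕ} (hl : l.Pairwise (· ≥ ·)) :
    (l : Multiset ℕ).sort (· ≥ ·) = l := by
  rw [Multiset.coe_sort]
  exact List.mergeSort_eq_self _ hl

theorem Finset.val_map_eq_sum {ι β : Type*} (s : Finset ι) (f : ι → β) :
    s.val.map f = ∑ i ∈ s, ({f i} : Multiset β) := by
  rw [← Multiset.sum_map_singleton (s.val.map f), Multiset.map_map]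
  rfl

namespace SimpleGraph

/-- The moments are power sums of the roots of the characteristic polynomial, which relabeling
preserves. -/
theorem spectralMoment_eq_of_iso {V W : Type*} [Fintype V] [Fintype W] {G : SimpleGraph V}
    {H : SimpleGraph W} (e : G ≃g H) (k : ℕ) : G.spectralMoment k = H.spectralMoment k := by
  have hm : (G.adjMatrix ℝ).charpoly = (H.adjMatrix ℝ).charpoly := by
    rw [← e.reindex_adjMatrix (α := ℝ), Matrix.charpoly_reindex]
  have h₁ : G.spectralMoment k = ((G.adjMatrix ℝ).charpoly.roots.map (· ^ k)).sum := by
    have hG : (G.adjMatrix ℝ).IsHermitian := G.isSymm_adjMatrix (α := ℝ)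
    rw [hG.roots_charpoly_eq_eigenvalues, Multiset.map_map]
    rfl
  have h₂ : H.spectralMoment k = ((H.adjMatrix ℝ).charpoly.roots.map (· ^ k)).sum := by
    have hH : (H.adjMatrix ℝ).IsHermitian := H.isSymm_adjMatrix (α := ℝ)
    rw [hH.roots_charpoly_eq_eigenvalues, Multiset.map_map]
    rfl
  rw [h₁, h₂, hm]

section Iso

variable {V W : Type*} {G : SimpleGraph V} {H : SimpleGraph W}

theorem Iso.dist_le (e : G ≃g H) (hH : H.Connected) (x y : V) :
    G.dist x y ≤ H.dist (e x) (e y) := by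
  obtain ⟨p, hp⟩ := hH.exists_walk_length_eq_dist (e x) (e y)
  rw [← hp, ← Walk.length_map e.symm.toHom p]
  have := SimpleGraph.dist_le (p.map e.symm.toHom)
  simpa using this

theorem Iso.dist_eq (e : G ≃g H) (hG : G.Connected) (x y : V) :
    H.dist (e x) (e y) = G.dist x y := by
  refine le_antisymm ?_ (e.dist_le (e.connected_iff.1 hG) x y)
  have := e.symm.dist_le hG (e x) (e y)
  simpa using this

variable [Fintype W]

theorem indepNum_le_of_iso (e : G ≃g H) : G.indepNum ≤ H.indepNum := by
  obtain ⟨s, hs⟩ := G.exists_isNIndepSet_indepNum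
  rw [← hs.card_eq, ← Finset.card_map e.toEquiv.toEmbedding]
  refine IsIndepSet.card_le_indepNum ?_
  intro x hx y hy _ hxy
  obtain ⟨x, hx', rfl⟩ := Finset.mem_map.1 (Finset.mem_coe.1 hx)
  obtain ⟨y, hy', rfl⟩ := Finset.mem_map.1 (Finset.mem_coe.1 hy)
  have := e.map_adj_iff.1 hxy
  exact hs.isIndepSet hx' hy' this.ne this

variable [Fintype V]

theorem leveledDegreeSequence_iso (e : G ≃g H) (hG : G.Connected) (r : V) (h : ℕ) :
    H.leveledDegreeSequence (e r) h = G.leveledDegreeSequence r h := by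
  unfold leveledDegreeSequence
  congr 1
  rw [Finset.val_map_eq_sum, Finset.val_map_eq_sum, Finset.sum_filter, Finset.sum_filter]
  refine (Fintype.sum_equiv e.toEquiv _ _ fun x => ?_).symm
  have h₁ : H.dist (e r) (e x) = G.dist r x := e.dist_eq hG r x
  have h₂ : H.degree (e x) = G.degree x := by convert e.degree_eq x
  simp [h₁, h₂]

theorem HasDegreeSequence.of_iso (e : G ≃g H) {D : List ℕ} (hG : G.HasDegreeSequence D) :
    H.HasDegreeSequence D := by
  refine ⟨hG.1, hG.2.trans ?_⟩
  rw [Finset.val_map_eq_sum, Finset.val_map_eq_sum]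
  refine Fintype.sum_equiv e.toEquiv _ _ fun x => ?_
  have h₂ : H.degree (e x) = G.degree x := by convert e.degree_eq x
  simp [h₂]

theorem IsGreedyTree.of_iso (e : G ≃g H) (hG : G.IsGreedyTree) : H.IsGreedyTree := by
  obtain ⟨r, ⟨hT, f, hf⟩, hd⟩ := hG
  have hl : H.leveledDegreeSequence (e r) = G.leveledDegreeSequence r :=
    funext fun h => leveledDegreeSequence_iso e hT.connected r h
  refine ⟨e r, ⟨e.isTree_iff.1 hT, ?_⟩, ?_⟩
  · rw [hl]
    exact ⟨e.symm.trans f, by simpa using hf⟩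
  · rw [hl]
    exact hd

theorem indepNum_eq_of_iso (e : G ≃g H) : G.indepNum = H.indepNum :=
  le_antisymm (indepNum_le_of_iso e) (indepNum_le_of_iso e.symm)

end Iso

section Degrees

variable (a b : ℕ)

theorem spider_connected : (spider (Fin a) (Fin b)).Connected := by
  refine connected_iff_exists_forall_reachable _ |>.2 ⟨none, ?_⟩
  have h₁ (i : Fin a) : (spider (Fin a) (Fin b)).Adj none (some (.inl (i, false))) := by
    simp [spider, spiderRel]
  rintro (_ | ⟨i, _ | _⟩ | j)
  · exact Reachable.refl _
  · exact (h₁ i).reachable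
  · refine (h₁ i).reachable.trans (Adj.reachable ?_)
    simp [spider, spiderRel]
  · refine Adj.reachable ?_
    simp [spider, spiderRel]

theorem degree_eq_sum {V : Type*} [Fintype V] (G : SimpleGraph V) (x : V) :
    G.degree x = ∑ y, if G.Adj x y then 1 else 0 := by
  rw [← card_neighborFinset_eq_degree, neighborFinset_eq_filter, Finset.card_filter]

theorem spider_degree_none : (spider (Fin a) (Fin b)).degree none = a + b := by
  rw [degree_eq_sum, Fintype.sum_option, Fintype.sum_sum_type, Fintype.sum_prod_type]
  simp only [Fintype.sum_bool]
  simp [spider, spiderRel]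

theorem spider_degree_inl_false (i : Fin a) :
    (spider (Fin a) (Fin b)).degree (some (.inl (i, false))) = 2 := by
  rw [degree_eq_sum, Fintype.sum_option, Fintype.sum_sum_type, Fintype.sum_prod_type]
  simp only [Fintype.sum_bool]
  simp [spider, spiderRel]

theorem spider_degree_inl_true (i : Fin a) :
    (spider (Fin a) (Fin b)).degree (some (.inl (i, true))) = 1 := by
  rw [degree_eq_sum, Fintype.sum_option, Fintype.sum_sum_type, Fintype.sum_prod_type]
  simp only [Fintype.sum_bool]
  simp [spider, spiderRel]

theorem spider_degree_inr (j : Fin b) :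
    (spider (Fin a) (Fin b)).degree (some (.inr j)) = 1 := by
  rw [degree_eq_sum, Fintype.sum_option, Fintype.sum_sum_type, Fintype.sum_prod_type]
  simp only [Fintype.sum_bool]
  simp [spider, spiderRel]

theorem spider_isTree : (spider (Fin a) (Fin b)).IsTree := by
  refine isTree_iff_connected_and_card.2 ⟨spider_connected a b, ?_⟩
  have := (spider (Fin a) (Fin b)).sum_degrees_eq_twice_card_edges
  rw [Fintype.sum_option, Fintype.sum_sum_type, Fintype.sum_prod_type] at this
  simp only [Fintype.sum_bool, spider_degree_none, spider_degree_inl_false, spider_degree_inl_true,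
    spider_degree_inr, Finset.sum_const, Finset.card_univ, Fintype.card_fin, smul_eq_mul] at this
  rw [Nat.card_eq_fintype_card, Nat.card_eq_fintype_card, ← edgeFinset_card]
  simp only [Fintype.card_option, Fintype.card_sum, Fintype.card_prod, Fintype.card_bool,
    Fintype.card_fin]
  omega

theorem spider_hasDegreeSequence (hb : 1 ≤ b) : (spider (Fin a) (Fin b)).HasDegreeSequence
    ((a + b) :: (List.replicate a 2 ++ List.replicate (a + b) 1)) := by
  constructor
  · rw [List.pairwise_cons, List.pairwise_append]
    simp only [List.mem_append, List.mem_replicate, List.pairwise_replicate]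
    refine ⟨?_, ?_, ?_, ?_⟩
    all_goals grind
  · rw [Finset.val_map_eq_sum, Fintype.sum_option, Fintype.sum_sum_type, Fintype.sum_prod_type]
    simp only [Fintype.sum_bool, spider_degree_none, spider_degree_inl_false,
      spider_degree_inl_true, spider_degree_inr, Finset.sum_const, Finset.card_univ,
      Fintype.card_fin, Multiset.nsmul_singleton, smul_add]
    rw [← Multiset.cons_coe, ← Multiset.coe_add, Multiset.coe_replicate, Multiset.coe_replicate,
      Multiset.replicate_add, ← Multiset.singleton_add]
    abel

theorem spider_dist_inl_false (i : Fin a) :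
    (spider (Fin a) (Fin b)).dist none (some (.inl (i, false))) = 1 := by
  rw [dist_eq_one_iff_adj]
  simp [spider, spiderRel]

theorem spider_dist_inr (j : Fin b) :
    (spider (Fin a) (Fin b)).dist none (some (.inr j)) = 1 := by
  rw [dist_eq_one_iff_adj]
  simp [spider, spiderRel]

theorem spider_dist_inl_true (i : Fin a) :
    (spider (Fin a) (Fin b)).dist none (some (.inl (i, true))) = 2 := by
  refine le_antisymm ?_ ?_
  · have h₁ : (spider (Fin a) (Fin b)).dist (some (.inl (i, false))) (some (.inl (i, true))) = 1 := by
      rw [dist_eq_one_iff_adj]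
      simp [spider, spiderRel]
    have := (spider_connected a b).dist_triangle (u := none) (v := some (.inl (i, false)))
      (w := some (.inl (i, true)))
    rw [h₁, spider_dist_inl_false] at this
    exact this
  · refine (spider_connected a b).one_lt_dist_of_ne_of_not_adj (by simp) ?_
    simp [spider, spiderRel]

/-- The degrees on the levels of a spider. -/
def spiderLevels (a b : ℕ) : ℕ → List ℕ
  | 0 => [a + b]
  | 1 => List.replicate a 2 ++ List.replicate b 1
  | 2 => List.replicate a 1
  | _ + 3 => []

theorem spider_leveledDegreeSequence :
    (spider (Fin a) (Fin b)).leveledDegreeSequence none = spiderLevels a b := by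
  funext h
  have key (h : ℕ) : (((Finset.univ.filter
      (fun v => (spider (Fin a) (Fin b)).dist none v = h)).val.map
        (fun v => (spider (Fin a) (Fin b)).degree v) : Multiset ℕ)) = spiderLevels a b h := by
    rw [Finset.val_map_eq_sum, Finset.sum_filter, Fintype.sum_option, Fintype.sum_sum_type,
      Fintype.sum_prod_type]
    simp only [Fintype.sum_bool, spider_degree_none, spider_degree_inl_false,
      spider_degree_inl_true, spider_degree_inr, spider_dist_inl_false, spider_dist_inl_true,
      spider_dist_inr, dist_self]
    rcases h with _ | _ | _ | h
    · simp [spiderLevels]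
    · simp only [spiderLevels, ← Multiset.coe_add, Multiset.coe_replicate]
      simp [Multiset.nsmul_singleton]
    · simp only [spiderLevels, Multiset.coe_replicate]
      simp [Multiset.nsmul_singleton]
    · simp [spiderLevels]
  unfold leveledDegreeSequence
  rw [key]
  refine Multiset.sort_coe_of_pairwise ?_
  rcases h with _ | _ | _ | h
  · simp [spiderLevels]
  · simp only [spiderLevels, List.pairwise_append, List.mem_replicate, List.pairwise_replicate]
    grind
  · simp [spiderLevels, List.pairwise_replicate]
  · simp [spiderLevels]

end Degrees

end SimpleGraph

end SpiderGraph

/-! ### The spider as the unique greedy tree with its degree sequence -/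

section Greedy

open scoped Classical

namespace SimpleGraph

/-- Child blocks of level 1: the first `a` vertices have one child each, the others none. -/
theorem sum_map_childCount_take_replicate (a b j : ℕ) :
    (((List.replicate a 2 ++ List.replicate b 1).take j).map (childCount 1)).sum = min j a := by
  simp [List.take_append, childCount]

theorem spider_nonempty_iso_levelGreedyForest (a b : ℕ) :
    ∃ e : spider (Fin a) (Fin b) ≃g levelGreedyForest (spiderLevels a b), (e none).1 = 0 := by
  have h₁ : (spiderLevels a b 1).length = a + b := by simp [spiderLevels]
  have h₂ : (spiderLevels a b 2).length = a := by simp [spiderLevels]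
  -- Long legs precede short legs on level 1 because degrees must be non-increasing there.
  let φ : Option ((Fin a × Bool) ⊕ Fin b) → Σ h : ℕ, Fin (spiderLevels a b h).length := fun x =>
    match x with
    | none => ⟨0, 0, by simp [spiderLevels]⟩
    | some (.inl (i, false)) => ⟨1, i, by omega⟩
    | some (.inl (i, true)) => ⟨2, i, by omega⟩
    | some (.inr j) => ⟨1, a + j, by omega⟩
  have inj : Function.Injective φ := by
    rintro (_ | ⟨d, _ | _⟩ | e) (_ | ⟨d', _ | _⟩ | e') hh <;> simp [φ] at hh ⊢ <;> omega
  have surj : Function.Surjective φ := by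
    rintro ⟨h, j, hj⟩
    rcases h with _ | _ | _ | h
    · refine ⟨none, ?_⟩
      simp [spiderLevels] at hj
      simp [φ, hj]
    · rw [zero_add, h₁] at hj
      by_cases hja : j < a
      · exact ⟨some (.inl (⟨j, hja⟩, false)), rfl⟩
      · refine ⟨some (.inr ⟨j - a, by omega⟩), ?_⟩
        simp only [φ]
        congr 2
        omega
    · rw [zero_add, one_add_one_eq_two, h₂] at hj
      exact ⟨some (.inl (⟨j, hj⟩, true)), rfl⟩
    · simp [spiderLevels] at hj
  suffices hadj : ∀ p q, (levelGreedyForest (spiderLevels a b)).Adj (φ p) (φ q) ↔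
      (spider (Fin a) (Fin b)).Adj p q from
    ⟨⟨Equiv.ofBijective φ ⟨inj, surj⟩, hadj _ _⟩, rfl⟩
  have hne (p q) : φ p ≠ φ q ↔ p ≠ q := inj.ne_iff
  intro p q
  rw [levelGreedyForest, spider, fromRel_adj, fromRel_adj, hne]
  refine and_congr_right fun _ => ?_
  have key (p q : Option ((Fin a × Bool) ⊕ Fin b)) : ((φ q).1 = (φ p).1 + 1 ∧
      (((spiderLevels a b (φ p).1).take ((φ p).2 : ℕ)).map (childCount (φ p).1)).sum
        ≤ ((φ q).2 : ℕ) ∧ ((φ q).2 : ℕ) <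
      (((spiderLevels a b (φ p).1).take (((φ p).2 : ℕ) + 1)).map (childCount (φ p).1)).sum) ↔
      spiderRel (Fin a) (Fin b) p q := by
    rcases p with _ | ⟨d, _ | _⟩ | e <;> rcases q with _ | ⟨d', _ | _⟩ | e' <;>
      simp only [φ, spiderRel, spiderLevels, sum_map_childCount_take_replicate]
    · simp
    · simp [childCount]
      omega
    · simp
    · simp [childCount]
    · simp
    · simp
    · simp [Fin.ext_iff]
      omega
    · simp
    · simp
    · simp
    · simp
    · simp
    · simp
    · simp
    · simp
    · simp
  exact or_congr (key p q) (key q p)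

theorem spider_isGreedyTree {a b : ℕ} (hb : 1 ≤ b) : (spider (Fin a) (Fin b)).IsGreedyTree := by
  refine ⟨none, ⟨spider_isTree a b, ?_⟩, ?_⟩
  · rw [spider_leveledDegreeSequence]
    exact spider_nonempty_iso_levelGreedyForest a b
  · rw [spider_leveledDegreeSequence]
    rintro (_ | _ | _ | h) x hx y hy
    · simp [spiderLevels] at hx hy
      omega
    · simp [spiderLevels] at hx hy
      omega
    · simp [spiderLevels] at hy
    · simp [spiderLevels] at hy

theorem Connected.exists_adj_of_dist_eq_succ {V : Type*} {G : SimpleGraph V} (hG : G.Connected)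
    {r y : V} {k : ℕ} (h : G.dist r y = k + 1) : ∃ x, G.Adj x y ∧ G.dist r x = k := by
  obtain ⟨p, hp⟩ := hG.exists_walk_length_eq_dist r y
  have hnil : ¬p.Nil := by
    rw [← Walk.length_eq_zero_iff]
    omega
  refine ⟨p.penultimate, p.adj_penultimate hnil, ?_⟩
  have h₁ := dist_le p.dropLast
  have h₂ := hG.dist_triangle (u := r) (v := p.penultimate) (w := y)
  rw [dist_eq_one_iff_adj.2 (p.adj_penultimate hnil)] at h₂
  rw [Walk.length_dropLast] at h₁
  omega

variable {V : Type*} [Fintype V] {G : SimpleGraph V}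

theorem degree_mem_leveledDegreeSequence (G : SimpleGraph V) (r x : V) :
    G.degree x ∈ G.leveledDegreeSequence r (G.dist r x) := by
  unfold leveledDegreeSequence
  rw [Multiset.mem_sort, Multiset.mem_map]
  exact ⟨x, by simp, rfl⟩

/-- Degrees do not increase from level to level, so the root has the largest degree a + b, and one
leaf on level 1 forces level 2 to consist of leaves. The long legs are then the non-root vertices of
degree 2. -/
theorem HasDegreeSequence.isSpider_of_isGreedyTree {a b : ℕ} (hb : 1 ≤ b)
    (hD : G.HasDegreeSequence ((a + b) :: (List.replicate a 2 ++ List.replicate (a + b) 1)))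
    (hG : G.IsGreedyTree) : ∃ r, G.IsSpider r ∧ (G.longLegs r).ncard = a := by
  obtain ⟨r, ⟨hT, -⟩, hmono⟩ := hG
  have hlevel {x y : V} (h : G.dist r y = G.dist r x + 1) : G.degree y ≤ G.degree x :=
    hmono (G.dist r x) _ (G.degree_mem_leveledDegreeSequence r x) _
      (h ▸ G.degree_mem_leveledDegreeSequence r y)
  have hmax (k : ℕ) (x : V) (hx : G.dist r x = k) : G.degree x ≤ G.degree r := by
    induction k generalizing x with
    | zero =>
      rw [(hT.connected.dist_eq_zero_iff.1 hx)]
    | succ k ih =>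
      obtain ⟨y, -, hy⟩ := hT.connected.exists_adj_of_dist_eq_succ hx
      exact (hlevel (by omega)).trans (ih y hy)
  obtain ⟨-, hD⟩ := hD
  have hr : G.degree r = a + b := by
    have h₁ : a + b ∈ Finset.univ.val.map (fun x => G.degree x) := by
      rw [← hD]
      simp
    obtain ⟨x, -, hx⟩ := Multiset.mem_map.1 h₁
    have h₂ := hmax _ x rfl
    have h₃ : G.degree r ∈ Finset.univ.val.map (fun x => G.degree x) :=
      Multiset.mem_map_of_mem _ (Finset.mem_univ r)
    rw [← hD] at h₃
    simp only [Multiset.mem_coe, List.mem_cons, List.mem_append, List.mem_replicate] at h₃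
    omega
  have hrest : (Finset.univ.erase r).val.map (fun x => G.degree x) =
      Multiset.replicate a 2 + Multiset.replicate (a + b) 1 := by
    have : Finset.univ.val = r ::ₘ (Finset.univ.erase r).val := by
      rw [Finset.erase_val, Multiset.cons_erase (Finset.mem_univ r)]
    rw [this, Multiset.map_cons, hr, ← Multiset.cons_coe, Multiset.cons_inj_right] at hD
    rw [← hD, ← Multiset.coe_add, Multiset.coe_replicate, Multiset.coe_replicate]
  have hcases {x : V} (hx : x ≠ r) : G.degree x = 2 ∨ G.degree x = 1 := by
    have : G.degree x ∈ (Finset.univ.erase r).val.map (fun x => G.degree x) :=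
      Multiset.mem_map_of_mem _ (Finset.mem_erase.2 ⟨hx, Finset.mem_univ x⟩)
    rw [hrest, Multiset.mem_add, Multiset.mem_replicate, Multiset.mem_replicate] at this
    exact this.imp And.right And.right
  have htwo : ((Finset.univ.erase r).filter fun x => 2 = G.degree x).card = a := by
    have := congrArg (Multiset.count 2) hrest
    rw [Multiset.count_map, Multiset.count_add, Multiset.count_replicate_self,
      Multiset.count_replicate, if_neg (by norm_num), add_zero] at this
    exact this
  -- Only `a` vertices besides the root have degree 2, fewer than its a + b neighbors.
  obtain ⟨x₀, hx₀, hd₀⟩ : ∃ x, G.Adj r x ∧ G.degree x = 1 := by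
    by_contra! h
    have hsub : G.neighborFinset r ⊆ (Finset.univ.erase r).filter fun x => 2 = G.degree x := by
      intro x hx
      rw [mem_neighborFinset] at hx
      rw [Finset.mem_filter]
      exact ⟨Finset.mem_erase.2 ⟨hx.ne.symm, Finset.mem_univ x⟩,
        ((hcases hx.ne.symm).resolve_right (h x hx)).symm⟩
    have := Finset.card_le_card hsub
    rw [htwo, card_neighborFinset_eq_degree] at this
    omega
  have hsecond {x y : V} (hx : G.Adj r x) (hy : G.Adj x y) (hyr : y ≠ r) : G.degree y ≤ 1 := by
    have h₁ := dist_eq_one_iff_adj.2 hx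
    have h₂ := dist_eq_one_iff_adj.2 hx₀
    have h₃ : G.dist r y ≠ 0 := fun h => hyr (hT.connected.dist_eq_zero_iff.1 h).symm
    rw [← hd₀]
    rcases hT.dist_eq_dist_add_one_of_adj r hy with h | h
    · omega
    · exact hlevel (by omega)
  refine ⟨r, ⟨hT.connected, fun x y hx hy hyr => ⟨fun z hz =>
    eq_of_adj_of_degree_le_one (hsecond hx hy hyr) hz hy.symm, fun z hz hzr => ?_⟩⟩, ?_⟩
  · by_contra hzy
    have hsub : ({r, y, z} : Finset V) ⊆ G.neighborFinset x := by
      intro w hw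
      rw [mem_neighborFinset]
      simp only [Finset.mem_insert, Finset.mem_singleton] at hw
      rcases hw with rfl | rfl | rfl
      exacts [hx.symm, hy, hz]
    have := Finset.card_le_card hsub
    rw [card_neighborFinset_eq_degree, Finset.card_eq_three.2
      ⟨r, y, z, hyr.symm, hzr.symm, Ne.symm hzy, rfl⟩] at this
    have := hcases hx.ne.symm
    omega
  · rw [← htwo, ← Set.ncard_coe_finset]
    congr 1
    ext x
    simp only [Finset.coe_filter, Finset.mem_erase, Finset.mem_univ, and_true, Set.mem_ofPred_eq]
    constructor
    · rintro ⟨hx, y, hy, hyr⟩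
      refine ⟨hx.ne.symm, ((hcases hx.ne.symm).resolve_right fun h => hyr ?_).symm⟩
      exact eq_of_adj_of_degree_le_one h.le hy hx.symm
    · rintro ⟨hxr, hx⟩
      have hall : x = r ∨ G.Adj r x ∨ ∃ y, G.Adj r y ∧ G.Adj y x ∧ x ≠ r := by
        refine hT.connected.mem_of_forall_adj (r := r)
          (S := {x | x = r ∨ G.Adj r x ∨ ∃ y, G.Adj r y ∧ G.Adj y x ∧ x ≠ r}) (Or.inl rfl) ?_ x
        rintro y (rfl | hy | ⟨w, hw, hwy, hyr⟩) z hz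
        · exact Or.inr (Or.inl hz)
        · by_cases hzr : z = r
          · exact Or.inl hzr
          · exact Or.inr (Or.inr ⟨y, hy, hz, hzr⟩)
        · rw [eq_of_adj_of_degree_le_one (hsecond hw hwy hyr) hz hwy.symm]
          exact Or.inr (Or.inl hw)
      rcases hall with h | h | ⟨y, hy, hyx, -⟩
      · exact absurd h hxr
      · refine ⟨h, ?_⟩
        by_contra! hn
        have hsub : G.neighborFinset x ⊆ {r} := fun y hy =>
          Finset.mem_singleton.2 (hn y ((mem_neighborFinset _ _ _).1 hy))
        have := Finset.card_le_card hsub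
        rw [card_neighborFinset_eq_degree, Finset.card_singleton] at this
        omega
      · have := hsecond hy hyx hxr
        omega

end SimpleGraph

end Greedy

/-! ### Independence number of the spider and its extremality -/

section Extremal

open scoped Classical

namespace SimpleGraph

/-- The neighbors of the center all lie on level 1, hence are independent. -/
theorem le_indepNum_spider (a b : ℕ) : a + b ≤ (spider (Fin a) (Fin b)).indepNum := by
  have h : (spider (Fin a) (Fin b)).IsIndepSet
      ((spider (Fin a) (Fin b)).neighborFinset none : Set _) := by
    intro x hx y hy _ hxy
    rw [Finset.mem_coe, mem_neighborFinset, ← dist_eq_one_iff_adj] at hx hy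
    exact (spider_isTree a b).dist_ne_of_adj none hxy (hx.trans hy.symm)
  have := h.card_le_indepNum
  rwa [card_neighborFinset_eq_degree, spider_degree_none] at this

/-- Each long leg supplies its outer edge, and the center is paired with the first short leg, which
is where 1 ≤ b enters. -/
theorem exists_isMatchingMap_spider {a b : ℕ} (hb : 1 ≤ b) :
    ∃ C f, (spider (Fin a) (Fin b)).IsMatchingMap C f ∧ C.card = a + 1 := by
  let c : Option (Fin a) → Option ((Fin a × Bool) ⊕ Fin b) := fun o =>
    o.elim none fun i => some (.inl (i, false))
  have hc : Function.Injective c := by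
    rintro (_ | i) (_ | j) h <;> simp_all [c]
  let f : Option ((Fin a × Bool) ⊕ Fin b) → Option ((Fin a × Bool) ⊕ Fin b) := fun x =>
    match x with
    | some (.inl (i, _)) => some (.inl (i, true))
    | _ => some (.inr ⟨0, hb⟩)
  refine ⟨Finset.univ.map ⟨c, hc⟩, f, ⟨?_, ?_, ?_⟩, by simp⟩
  · intro x hx
    obtain ⟨_ | i, -, rfl⟩ := Finset.mem_map.1 hx <;> simp [c, f, spider, spiderRel]
  · intro x hx hfx
    obtain ⟨_ | i, -, rfl⟩ := Finset.mem_map.1 hx <;>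
      obtain ⟨_ | j, -, h⟩ := Finset.mem_map.1 hfx <;> simp [c, f] at h
  · intro x hx y hy hxy
    obtain ⟨_ | i, -, rfl⟩ := Finset.mem_map.1 (Finset.mem_coe.1 hx) <;>
      obtain ⟨_ | j, -, rfl⟩ := Finset.mem_map.1 (Finset.mem_coe.1 hy) <;>
      simp_all [c, f]

theorem spider_indepNum {a b : ℕ} (hb : 1 ≤ b) :
    (spider (Fin a) (Fin b)).indepNum = a + b := by
  refine le_antisymm ?_ (le_indepNum_spider a b)
  obtain ⟨C, f, hf, hC⟩ := exists_isMatchingMap_spider (a := a) hb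
  have h₁ := hf.card_le_matchingNum
  have h₂ := (spider (Fin a) (Fin b)).indepNum_add_matchingNum_le
  simp only [Fintype.card_option, Fintype.card_sum, Fintype.card_prod, Fintype.card_bool,
    Fintype.card_fin] at h₂
  omega

/-- Spiders have the largest spectral moments among the trees with the same number of vertices and
the same independence number. -/
theorem IsTree.spectralMoment_le_spider {V : Type*} [Fintype V] {T : SimpleGraph V}
    (hT : T.IsTree) {a b : ℕ} (hV : Fintype.card V = 1 + 2 * a + b) (hI : T.indepNum = a + b)
    (k : ℕ) : T.spectralMoment k ≤ (spider (Fin a) (Fin b)).spectralMoment k := by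
  obtain ⟨C, f, hf, hC, -⟩ := hT.exists_isMatchingMap_card
  obtain ⟨m, hm, hadj, hmC⟩ := hf.exists_involutive
  have hcard := hf.card_union_image
  obtain ⟨G, r, hG, hl, hle⟩ := hT.exists_isSpider_spectralMoment_le ⟨hm, hadj⟩ hmC
    (Finset.card_pos.1 (by omega))
  obtain ⟨e⟩ := hG.nonempty_iso (a := a) (b := b) (by omega) hV
  exact (hle k).trans (spectralMoment_eq_of_iso e k).le

end SimpleGraph

end Extremal

theorem mainTheorem11 {V : Type*} [Fintype V] (n α : ℕ) (hn : Fintype.card V = n)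
    (hα : n ≤ 2 * α) (hαn : α < n) :
    ∃ G : SimpleGraph V,
      -- `G` is the greedy tree (unique up to isomorphism) with the given degree sequence
      (G.IsGreedyTree ∧
        G.HasDegreeSequence (α :: (List.replicate (n - α - 1) 2 ++ List.replicate α 1))) ∧
      (∀ H : SimpleGraph V, H.IsGreedyTree →
        H.HasDegreeSequence (α :: (List.replicate (n - α - 1) 2 ++ List.replicate α 1)) →
        Nonempty (H ≃g G)) ∧
      -- `G` belongs to the class of trees under consideration
      G.IsTree ∧ G.indepNum = α ∧ G.matchingNum = n - α ∧
      -- the two descriptions of the class agree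
      (∀ T : SimpleGraph V, T.IsTree → (T.indepNum = α ↔ T.matchingNum = n - α)) ∧
      -- `G` has the largest spectral moments
      (∀ T : SimpleGraph V, T.IsTree → T.indepNum = α →
        ∀ k : ℕ, T.spectralMoment k ≤ G.spectralMoment k) ∧
      (∀ T : SimpleGraph V, T.IsTree → T.matchingNum = n - α →
        ∀ k : ℕ, T.spectralMoment k ≤ G.spectralMoment k) := by
  classical
  -- The equations a + b = α and 1 + 2a + b = n for a spider determine both numbers of legs; n ≤ 2α
  -- ensures at least one short leg.
  obtain ⟨a, ha⟩ : ∃ a, n - α - 1 = a := ⟨_, rfl⟩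
  obtain ⟨b, hb⟩ : ∃ b, 2 * α + 1 - n = b := ⟨_, rfl⟩
  have hαab : α = a + b := by omega
  have hb1 : 1 ≤ b := by omega
  have hV : Fintype.card V = 1 + 2 * a + b := by omega
  rw [ha, hαab]
  have hcard : Fintype.card V = Fintype.card (Option ((Fin a × Bool) ⊕ Fin b)) := by
    simp only [Fintype.card_option, Fintype.card_sum, Fintype.card_prod, Fintype.card_bool,
      Fintype.card_fin]
    omega
  let G : SimpleGraph V :=
    (SimpleGraph.spider (Fin a) (Fin b)).comap (Fintype.equivOfCardEq hcard)
  let e : G ≃g SimpleGraph.spider (Fin a) (Fin b) := SimpleGraph.Iso.comap _ _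
  have hGT : G.IsTree := e.isTree_iff.2 (SimpleGraph.spider_isTree a b)
  have hGI : G.indepNum = a + b :=
    (SimpleGraph.indepNum_eq_of_iso e).trans (SimpleGraph.spider_indepNum hb1)
  have hiff (T : SimpleGraph V) (hT : T.IsTree) :
      T.indepNum = a + b ↔ T.matchingNum = n - (a + b) := by
    have := hT.indepNum_add_matchingNum
    omega
  have hle (T : SimpleGraph V) (hT : T.IsTree) (hI : T.indepNum = a + b) (k : ℕ) :
      T.spectralMoment k ≤ G.spectralMoment k :=
    (hT.spectralMoment_le_spider hV hI k).trans (SimpleGraph.spectralMoment_eq_of_iso e k).ge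
  refine ⟨G, ⟨(SimpleGraph.spider_isGreedyTree hb1).of_iso e.symm,
    (SimpleGraph.spider_hasDegreeSequence a b hb1).of_iso e.symm⟩, fun H hH hD => ?_, hGT, hGI,
    (hiff G hGT).1 hGI, hiff, hle, fun T hT hM => hle T hT ((hiff T hT).2 hM)⟩
  obtain ⟨r, hr, hl⟩ := hD.isSpider_of_isGreedyTree hb1 hH
  obtain ⟨f⟩ := hr.nonempty_iso hl hV
  exact ⟨f.trans e.symm⟩
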